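/- For real $-1 \le \beta < 0 \le \alpha < 1$ and $d \in \mathbb N$, let $N_{\alpha,\beta}(d)$ be the maximum size of a set of unit vectors in $\mathbb R^d$ in which any two distinct vectors have inner product $\alpha$ or $\beta$. For $\lambda > 0$, let $k(\lambda)$ be the smallest integer $k$ such that some graph on $k$ vertices has adjacency spectral radius (largest adjacency eigenvalue) exactly $\lambda$, and set $k(\lambda) = \infty$ if there is no such graph. Fix $-1 \le \beta < 0 \le \alpha < 1$, and set $$\lambda = \frac{1-\alpha}{\alpha-\beta}, \qquad p = \left\lfloor -\frac{\alpha}{\beta} \right\rfloor + 1, \qquad q = \max\{1, p/2\}.$$ Then $N_{\alpha,\beta}(d)$ is finite for every $d$, and $$N_{\alpha,\beta}(d) \le \begin{cases} \dfrac{q\,k(\lambda)\,d}{k(\lambda)-1} + O_{\alpha,\beta}(1) & \text{if } k(\lambda) < \infty, \\[2mm] q d + o(d) & \text{if } k(\lambda) = \infty, \end{cases}$$ where the constant in $O_{\alpha,\beta}(1)$ depends only on $\alpha$ and $\beta$, and $o(d)$ is meant for $d \to \infty$ with $\alpha, \beta$ fixed. -/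

import Mathlib

/-- `S` is a spherical `A`-code in `ℝ^d`: a set of unit vectors whose pairwise inner products
(over distinct elements) lie in `A`. -/
def IsSphericalCode (A : Set ℝ) {d : ℕ} (S : Set (EuclideanSpace ℝ (Fin d))) : Prop :=
  (∀ x ∈ S, ‖x‖ = 1) ∧ ∀ x ∈ S, ∀ y ∈ S, x ≠ y → inner ℝ x y ∈ A

/-- `N_A(d)`, the maximum size of a spherical `A`-code in `ℝ^d`, as an extended natural number
(a finite supremum of extended naturals over a nonempty family is attained). -/
noncomputable def maxCodeSize (A : Set ℝ) (d : ℕ) : ℕ∞ :=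
  ⨆ (S : Set (EuclideanSpace ℝ (Fin d))) (_ : IsSphericalCode A S), S.encard

/-- `lam = λ₁(G)`: `lam` is the largest eigenvalue of the adjacency matrix of `G`, which for a graph
is its spectral radius. -/
def IsTopEigenvalue {k : ℕ} (G : SimpleGraph (Fin k)) (lam : ℝ) : Prop :=
  open scoped Classical in IsGreatest (spectrum ℝ (G.adjMatrix ℝ)) lam

/-- The spectral radius order `k(lam)`: the least number of vertices of a graph with spectral
radius exactly `lam`, and `⊤` if there is no such graph. -/
noncomputable def spectralRadiusOrder (lam : ℝ) : ℕ∞ :=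
  ⨅ (k : ℕ) (_ : ∃ G : SimpleGraph (Fin k), IsTopEigenvalue G lam), (k : ℕ∞)

/-! Join two code vectors when their inner product is `β`. Nonnegativity of Gram forms excludes
large cliques, large balanced splits of an independent set by a vertex, and complete `(p +
1)`-partite patterns with large parts. Ramsey's theorem then makes the graph complete `p`-partite,
up to boundedly many vertices and a bounded-degree error `H` (`exists_bounded_degree_partition`).

Restrict to one or two parts and flip the sign of the vectors in one of them. The Gram matrix
becomes `(1 - α) I - (α - β) A_H` plus a matrix of rank at most two. Its rank is at most `d`, so the
number of vectors is at most `d + 2` plus the multiplicity of `lam` for `H`. Its positivity makes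
`lam I - A_H` nonnegative in codimension two, so at most two mutually separated sets of vertices can
exceed `lam`.

The core is `exists_finrank_le`: this multiplicity is at most `ε |V| + O(1)`. A component that does
not exceed `lam` carries at most one dimension, by Perron–Frobenius; if it carries one, it has
spectral radius `lam` and hence at least `1 / ε` vertices. In the at most two other components, all
but boundedly many balls still have norm at most `lam`. Deleting a sparse net loses closed walks at
every vertex, so powers of the adjacency matrix decay relative to powers of `lam`; few eigenvectors
can vanish on the net.

Finally the bounds for pairs of parts are summed cyclically, giving the factor `q`, with `ε = 1 /
k(lam)` or `ε` arbitrarily small. -/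

/-! ### Ramsey arguments and almost complete multipartite graphs. -/

open scoped Classical in
/-- Ramsey's theorem for graphs, with the binomial bound. -/
theorem exists_clique_or_indep {V : Type*} (G : SimpleGraph V) (K L : ℕ) (S : Finset V)
    (hS : (K + L).choose K ≤ S.card) :
    (∃ T ⊆ S, T.card = K ∧ ∀ x ∈ T, ∀ y ∈ T, x ≠ y → G.Adj x y) ∨
    (∃ T ⊆ S, T.card = L ∧ ∀ x ∈ T, ∀ y ∈ T, ¬ G.Adj x y) := by
  induction hn : K + L generalizing K L S with
  | zero =>
    obtain ⟨rfl, rfl⟩ : K = 0 ∧ L = 0 := by omega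
    exact Or.inl ⟨∅, by simp, by simp, by simp⟩
  | succ n ih =>
    rcases K with _ | K
    · exact Or.inl ⟨∅, by simp, by simp, by simp⟩
    rcases L with _ | L
    · exact Or.inr ⟨∅, by simp, by simp, by simp⟩
    have hpos : 0 < S.card := lt_of_lt_of_le (Nat.choose_pos (by omega)) hS
    obtain ⟨v, hv⟩ := Finset.card_pos.mp hpos
    have hsplit : ((S.erase v).filter (G.Adj v)).card +
        ((S.erase v).filter (fun w => ¬ G.Adj v w)).card = (S.erase v).card :=
      Finset.card_filter_add_card_filter_not _
    have hcard : (S.erase v).card + 1 = S.card := Finset.card_erase_add_one hv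
    have hch : (K + 1 + (L + 1)).choose (K + 1) =
        (K + (L + 1)).choose K + (K + 1 + L).choose (K + 1) := by
      rw [show K + 1 + (L + 1) = (K + (L + 1)) + 1 by ring, Nat.choose_succ_succ,
        show K + 1 + L = K + (L + 1) by ring]
    by_cases h1 : (K + (L + 1)).choose K ≤ ((S.erase v).filter (G.Adj v)).card
    · rcases ih K (L + 1) _ h1 (by omega) with ⟨T, hTS, hT, hadj⟩ | ⟨T, hTS, hT, hadj⟩
      · refine Or.inl ⟨insert v T, ?_, ?_, ?_⟩
        · intro x hx
          rcases Finset.mem_insert.mp hx with rfl | hx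
          · exact hv
          · exact Finset.mem_of_mem_erase (Finset.mem_filter.mp (hTS hx)).1
        · rw [Finset.card_insert_of_notMem, hT]
          intro hvT
          simpa using hTS hvT
        · have hvT : ∀ x ∈ T, G.Adj v x := fun x hx => (Finset.mem_filter.mp (hTS hx)).2
          intro x hx y hy hxy
          rcases Finset.mem_insert.mp hx with rfl | hx' <;>
          rcases Finset.mem_insert.mp hy with rfl | hy'
          · exact absurd rfl hxy
          · exact hvT y hy'
          · exact (hvT x hx').symm
          · exact hadj x hx' y hy' hxy
      · exact Or.inr ⟨T, fun x hx =>
          Finset.mem_of_mem_erase (Finset.mem_filter.mp (hTS hx)).1, hT, hadj⟩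
    · have h2 : (K + 1 + L).choose (K + 1) ≤
          ((S.erase v).filter (fun w => ¬ G.Adj v w)).card := by omega
      rcases ih (K + 1) L _ h2 (by omega) with ⟨T, hTS, hT, hadj⟩ | ⟨T, hTS, hT, hadj⟩
      · exact Or.inl ⟨T, fun x hx =>
          Finset.mem_of_mem_erase (Finset.mem_filter.mp (hTS hx)).1, hT, hadj⟩
      · refine Or.inr ⟨insert v T, ?_, ?_, ?_⟩
        · intro x hx
          rcases Finset.mem_insert.mp hx with rfl | hx
          · exact hv
          · exact Finset.mem_of_mem_erase (Finset.mem_filter.mp (hTS hx)).1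
        · rw [Finset.card_insert_of_notMem, hT]
          intro hvT
          simpa using hTS hvT
        · have hvT : ∀ x ∈ T, ¬ G.Adj v x := fun x hx => (Finset.mem_filter.mp (hTS hx)).2
          intro x hx y hy
          rcases Finset.mem_insert.mp hx with rfl | hx' <;>
          rcases Finset.mem_insert.mp hy with rfl | hy'
          · exact G.loopless.irrefl _
          · exact hvT y hy'
          · exact fun h => hvT x hx' h.symm
          · exact hadj x hx' y hy'

/-- `G` has no clique on `K` vertices. -/
def NoClique {V : Type*} (G : SimpleGraph V) (K : ℕ) : Prop :=
  ∀ T : Finset V, (∀ x ∈ T, ∀ y ∈ T, x ≠ y → G.Adj x y) → T.card ≠ K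

/-- No vertex of `G` splits an independent set into `L` neighbours and `L` non-neighbours. -/
def NoSplit {V : Type*} (G : SimpleGraph V) (L : ℕ) : Prop :=
  ∀ (v : V) (A B : Finset V), L ≤ A.card → L ≤ B.card →
    (∀ x ∈ A, ∀ y ∈ A, ¬ G.Adj x y) → (∀ x ∈ B, ∀ y ∈ B, ¬ G.Adj x y) →
    (∀ x ∈ A, ∀ y ∈ B, ¬ G.Adj x y) → (∀ x ∈ A, G.Adj v x) → (∀ x ∈ B, ¬ G.Adj v x) → False

/-- The sets `I i` are independent of size at least `L`, and completely joined to each other. -/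
def IsMultipartite {V : Type*} (G : SimpleGraph V) (m L : ℕ) (I : Fin m → Finset V) : Prop :=
  (∀ i, L ≤ (I i).card) ∧ (∀ i, ∀ x ∈ I i, ∀ y ∈ I i, ¬ G.Adj x y) ∧
    ∀ i j, i ≠ j → ∀ x ∈ I i, ∀ y ∈ I j, G.Adj x y

theorem NoClique.exists_indep {V : Type*} {G : SimpleGraph V} {K : ℕ} (hK : NoClique G K) (L : ℕ)
    (S : Finset V) (hS : (K + L).choose K ≤ S.card) :
    ∃ T ⊆ S, T.card = L ∧ ∀ x ∈ T, ∀ y ∈ T, ¬ G.Adj x y := by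
  rcases exists_clique_or_indep G K L S hS with ⟨T, -, hT, h⟩ | h
  · exact absurd hT (hK T h)
  · exact h

open scoped Classical in
theorem le_card_filter_forall_not {V : Type*} (r : V → V → Prop) [∀ t, DecidablePred (r t)]
    (T I : Finset V) [DecidablePred fun x => ∀ t ∈ T, ¬ r t x] (L : ℕ)
    (h : ∀ t ∈ T, (I.filter (r t)).card ≤ L) :
    I.card ≤ (I.filter (fun x => ∀ t ∈ T, ¬ r t x)).card + T.card * L := by
  have h1 : I ⊆ (I.filter (fun x => ∀ t ∈ T, ¬ r t x)) ∪ T.biUnion (fun t => I.filter (r t)) := by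
    intro x hx
    by_cases hx' : ∀ t ∈ T, ¬ r t x
    · exact Finset.mem_union_left _ (Finset.mem_filter.mpr ⟨hx, hx'⟩)
    · push Not at hx'
      obtain ⟨t, ht, htx⟩ := hx'
      exact Finset.mem_union_right _
        (Finset.mem_biUnion.mpr ⟨t, ht, Finset.mem_filter.mpr ⟨hx, htx⟩⟩)
  calc I.card ≤ _ := Finset.card_le_card h1
    _ ≤ _ := Finset.card_union_le _ _
    _ ≤ _ := Nat.add_le_add_left (Finset.card_biUnion_le_card_mul _ _ _ h) _

-- If both sets were large, `v` would split `I` in the forbidden way.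
open scoped Classical in
theorem NoSplit.sparse_or_dense {V : Type*} {G : SimpleGraph V} {L : ℕ} (hs : NoSplit G L)
    (v : V) (I : Finset V) (hI : ∀ x ∈ I, ∀ y ∈ I, ¬ G.Adj x y) :
    (I.filter (G.Adj v)).card ≤ L ∨ (I.filter (fun w => ¬ G.Adj v w)).card ≤ L := by
  by_contra! h
  refine hs v _ _ h.1.le h.2.le ?_ ?_ ?_ ?_ ?_ <;>
    simp only [Finset.mem_filter] <;> grind

-- Otherwise Ramsey gives an independent set of `M` such vertices. Discarding their at most `M * L`
-- non-neighbours from each `I i` leaves at least `M` vertices, so this set would be a further part.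
open scoped Classical in
theorem IsMultipartite.card_dense_lt {V : Type*} [Fintype V] {G : SimpleGraph V} {K L M N m : ℕ}
    (hK : NoClique G K) {I : Fin m → Finset V} (hI : IsMultipartite G m N I)
    (hN : M + M * L ≤ N) (hmax : ¬ ∃ J, IsMultipartite G (m + 1) M J) :
    (Finset.univ.filter
      (fun v => ∀ i, ((I i).filter (fun w => ¬ G.Adj v w)).card ≤ L)).card < (K + M).choose K := by
  by_contra! h
  obtain ⟨T, hT, hTc, hTi⟩ := hK.exists_indep M _ h
  apply hmax
  refine ⟨Fin.cons T (fun i => (I i).filter (fun x => ∀ t ∈ T, ¬ ¬ G.Adj t x)), ?_, ?_, ?_⟩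
  · intro i
    refine Fin.cases ?_ (fun i => ?_) i
    · simp [hTc]
    · have h1 := le_card_filter_forall_not (fun t x => ¬ G.Adj t x) T (I i) L
        (fun t ht => (Finset.mem_filter.mp (hT ht)).2 i)
      have := hI.1 i
      rw [hTc] at h1
      simp only [Fin.cons_succ]
      omega
  · intro i
    refine Fin.cases ?_ (fun i => ?_) i
    · simpa using hTi
    · simp only [Fin.cons_succ, Finset.mem_filter]
      intro x hx y hy
      exact hI.2.1 i x hx.1 y hy.1
  · intro i j
    refine Fin.cases ?_ (fun i => ?_) i <;> refine Fin.cases ?_ (fun j => ?_) j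
    · simp
    · intro _ x hx y hy
      simp only [Fin.cons_succ, Fin.cons_zero, Finset.mem_filter] at hx hy
      exact not_not.mp (hy.2 x hx)
    · intro _ x hx y hy
      simp only [Fin.cons_succ, Fin.cons_zero, Finset.mem_filter] at hx hy
      exact (not_not.mp (hx.2 y hy)).symm
    · intro hij x hx y hy
      simp only [Fin.cons_succ, Finset.mem_filter] at hx hy
      exact hI.2.2 i j (fun h => hij (by rw [h])) x hx.1 y hy.1

-- Otherwise take an independent `L`-set `T` of such vertices. Some `v ∈ I j` has no neighbour in
-- `T`, yet is joined to all of `I i`, of which many vertices also miss `T`: `v` splits an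
-- independent set.
open scoped Classical in
theorem IsMultipartite.card_sparse_two_lt {V : Type*} [Fintype V] {G : SimpleGraph V}
    {K L N m : ℕ} (hK : NoClique G K) (hs : NoSplit G L) (hL : 1 ≤ L)
    {I : Fin m → Finset V} (hI : IsMultipartite G m N I)
    (hN : L + L * L ≤ N) {i j : Fin m} (hij : i ≠ j) :
    (Finset.univ.filter (fun v => ((I i).filter (G.Adj v)).card ≤ L ∧
      ((I j).filter (G.Adj v)).card ≤ L)).card < (K + L).choose K := by
  by_contra! h
  obtain ⟨T, hT, hTc, hTi⟩ := hK.exists_indep L _ h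
  have hi := le_card_filter_forall_not G.Adj T (I i) L
    (fun t ht => (Finset.mem_filter.mp (hT ht)).2.1)
  have hj := le_card_filter_forall_not G.Adj T (I j) L
    (fun t ht => (Finset.mem_filter.mp (hT ht)).2.2)
  have h1 := hI.1 i
  have h2 := hI.1 j
  rw [hTc] at hi hj
  have hpos : 0 < ((I j).filter (fun x => ∀ t ∈ T, ¬ G.Adj t x)).card := by omega
  obtain ⟨v, hv⟩ := Finset.card_pos.mp hpos
  rw [Finset.mem_filter] at hv
  refine hs v ((I i).filter (fun x => ∀ t ∈ T, ¬ G.Adj t x)) T (by omega) hTc.ge ?_ hTi ?_ ?_ ?_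
  · simp only [Finset.mem_filter]
    exact fun x hx y hy => hI.2.1 i x hx.1 y hy.1
  · simp only [Finset.mem_filter]
    exact fun x hx y hy hxy => hx.2 y hy hxy.symm
  · simp only [Finset.mem_filter]
    exact fun x hx => hI.2.2 j i hij.symm v hv.1 x hx.1
  · exact fun x hx hvx => hv.2 x hx hvx.symm

open scoped Classical in
/-- A vertex sparse to an independent set `I` has few neighbours among the vertices sparse to `I`. -/
theorem NoSplit.card_adj_sparse_lt {V : Type*} [Fintype V] {G : SimpleGraph V}
    {K L : ℕ} (hK : NoClique G K) (hs : NoSplit G L) {I : Finset V}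
    (hI : ∀ x ∈ I, ∀ y ∈ I, ¬ G.Adj x y) (hN : 2 * L + L * L ≤ I.card) {v : V}
    (hv : (I.filter (G.Adj v)).card ≤ L) :
    (Finset.univ.filter (fun w => (I.filter (G.Adj w)).card ≤ L ∧ G.Adj v w)).card
      < (K + L).choose K := by
  by_contra! h
  obtain ⟨T, hT, hTc, hTi⟩ := hK.exists_indep L _ h
  have hi := le_card_filter_forall_not G.Adj T (I.filter (fun w => ¬ G.Adj v w)) L
    (fun t ht => (Finset.card_le_card (Finset.filter_subset_filter _
      (Finset.filter_subset _ _))).trans (Finset.mem_filter.mp (hT ht)).2.1)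
  have h3 : (I.filter (G.Adj v)).card + (I.filter (fun w => ¬ G.Adj v w)).card = I.card :=
      Finset.card_filter_add_card_filter_not _
  rw [hTc] at hi
  refine hs v T _ hTc.ge (by omega :
    L ≤ ((I.filter (fun w => ¬ G.Adj v w)).filter (fun x => ∀ t ∈ T, ¬ G.Adj t x)).card)
    hTi ?_ ?_ ?_ ?_
  · simp only [Finset.mem_filter]
    exact fun x hx y hy => hI x hx.1.1 y hy.1.1
  · simp only [Finset.mem_filter]
    exact fun x hx y hy => hy.2 x hx
  · exact fun x hx => (Finset.mem_filter.mp (hT hx)).2.2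
  · simp only [Finset.mem_filter]
    exact fun x hx => hx.1.2

open scoped Classical in
/-- A vertex dense to an independent set `I` has few non-neighbours among the vertices sparse to
`I`. -/
theorem NoSplit.card_not_adj_sparse_lt {V : Type*} [Fintype V] {G : SimpleGraph V}
    {K L : ℕ} (hK : NoClique G K) (hs : NoSplit G L) {I : Finset V}
    (hI : ∀ x ∈ I, ∀ y ∈ I, ¬ G.Adj x y) (hN : 2 * L + L * L ≤ I.card) {v : V}
    (hv : (I.filter (fun w => ¬ G.Adj v w)).card ≤ L) :
    (Finset.univ.filter (fun w => (I.filter (G.Adj w)).card ≤ L ∧ ¬ G.Adj v w)).card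
      < (K + L).choose K := by
  by_contra! h
  obtain ⟨T, hT, hTc, hTi⟩ := hK.exists_indep L _ h
  have hi := le_card_filter_forall_not G.Adj T (I.filter (G.Adj v)) L
    (fun t ht => (Finset.card_le_card (Finset.filter_subset_filter _
      (Finset.filter_subset _ _))).trans (Finset.mem_filter.mp (hT ht)).2.1)
  have h3 : (I.filter (G.Adj v)).card + (I.filter (fun w => ¬ G.Adj v w)).card = I.card :=
      Finset.card_filter_add_card_filter_not _
  rw [hTc] at hi
  refine hs v _ T (by omega :
    L ≤ ((I.filter (G.Adj v)).filter (fun x => ∀ t ∈ T, ¬ G.Adj t x)).card) hTc.ge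
    ?_ hTi ?_ ?_ ?_
  · simp only [Finset.mem_filter]
    exact fun x hx y hy => hI x hx.1.1 y hy.1.1
  · simp only [Finset.mem_filter]
    exact fun x hx y hy hxy => hx.2 y hy hxy.symm
  · simp only [Finset.mem_filter]
    exact fun x hx => hx.1.2
  · exact fun x hx => (Finset.mem_filter.mp (hT hx)).2.2

open scoped Classical in
/-- A graph without large cliques, split independent sets or complete `(p + 1)`-partite induced
subgraphs is, up to boundedly many vertices and bounded degrees, complete `p`-partite. -/
theorem exists_bounded_degree_partition (K L p : ℕ) (hL : 1 ≤ L) :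
    ∃ C D : ℕ, ∀ (V : Type) [Fintype V] (G : SimpleGraph V), NoClique G K → NoSplit G L →
      (¬ ∃ I, IsMultipartite G (p + 1) L I) → ∃ f : V → Option (Fin p),
        (Finset.univ.filter (fun v => f v = none)).card ≤ C ∧
        ∀ v i, f v = some i →
          (Finset.univ.filter (fun w => f w = some i ∧ G.Adj v w)).card ≤ D ∧
          ∀ j, j ≠ i → (Finset.univ.filter (fun w => f w = some j ∧ ¬ G.Adj v w)).card ≤ D := by
  -- Thresholds fall by a factor `L + 2` per added part and end at `L` for `p + 1` parts. Each drop
  -- pays for the vertices pruned when a part is added.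
  set s : ℕ → ℕ := fun m => L * (L + 2) ^ (p + 1 - m) with hs_def
  refine ⟨(K + s 0).choose K + p * (p * (K + L).choose K), (K + L).choose K, ?_⟩
  intro V _ G hK hs hmulti
  -- An induced multipartite pattern that cannot be extended at the next threshold.
  have hex : ∃ m, m ≤ p ∧ (∃ I, IsMultipartite G m (s m) I) ∧
      ¬ ∃ I, IsMultipartite G (m + 1) (s (m + 1)) I := by
    by_contra! hcon
    have : ∀ m, m ≤ p + 1 → ∃ I, IsMultipartite G m (s m) I := by
      intro m
      induction m with
      | zero => exact fun _ => ⟨Fin.elim0, fun i => i.elim0, fun i => i.elim0, fun i => i.elim0⟩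
      | succ m ih =>
        intro hm
        obtain ⟨I, hI⟩ := ih (by omega)
        exact hcon m (by omega) ⟨I, hI⟩
    apply hmulti
    simpa [hs_def] using this (p + 1) le_rfl
  obtain ⟨m, hmp, ⟨I, hI⟩, hmax⟩ := hex
  have hsm : s m = (L + 2) * s (m + 1) := by
    simp only [hs_def]
    rw [show p + 1 - m = (p + 1 - (m + 1)) + 1 by omega, pow_succ]
    ring
  have hsL : L ≤ s (m + 1) := Nat.le_mul_of_pos_right _ (by positivity)
  have hs0 : s (m + 1) ≤ s 0 :=
    Nat.mul_le_mul_left _ (Nat.pow_le_pow_right (by omega) (by omega))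
  have hN1 : s (m + 1) + s (m + 1) * L ≤ s m := by rw [hsm]; nlinarith
  have hN2 : 2 * L + L * L ≤ s m := by rw [hsm]; nlinarith
  set sp : Fin m → V → Prop := fun i v => ((I i).filter (G.Adj v)).card ≤ L with hsp
  have hdense : ∀ i v, ¬ sp i v → ((I i).filter (fun w => ¬ G.Adj v w)).card ≤ L := fun i v h =>
    (hs.sparse_or_dense v (I i) (hI.2.1 i)).resolve_left h
  -- A vertex joins the only part to which it is sparse. The exceptional vertices are dense to all
  -- parts or sparse to two.
  let f : V → Option (Fin p) := fun v =>
    if h : ∃! i, sp i v then some (Fin.castLE hmp h.choose) else none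
  have hf : ∀ v i, f v = some i → ∃ i' : Fin m, Fin.castLE hmp i' = i ∧ sp i' v ∧
      ∀ j, sp j v → j = i' := by
    intro v i hvi
    by_cases h : ∃! i, sp i v
    · simp only [f, dif_pos h, Option.some.injEq] at hvi
      exact ⟨h.choose, hvi, h.choose_spec⟩
    · simp [f, dif_neg h] at hvi
  refine ⟨f, ?_, ?_⟩
  · have hsub : Finset.univ.filter (fun v => f v = none) ⊆
        (Finset.univ.filter
          (fun v => ∀ i, ((I i).filter (fun w => ¬ G.Adj v w)).card ≤ L)) ∪
        Finset.univ.biUnion (fun i : Fin m => Finset.univ.biUnion (fun j : Fin m =>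
          Finset.univ.filter (fun v => i ≠ j ∧ sp i v ∧ sp j v))) := by
      intro v hv
      have hnu : ¬ ∃! i, sp i v := by
        intro h
        have hv' := (Finset.mem_filter.mp hv).2
        simp only [f, dif_pos h] at hv'
        exact Option.some_ne_none _ hv'
      by_cases h : ∃ i, sp i v
      · obtain ⟨i, hi⟩ := h
        have : ∃ j, sp j v ∧ j ≠ i := by
          by_contra! h'
          exact hnu ⟨i, hi, h'⟩
        obtain ⟨j, hj, hji⟩ := this
        refine Finset.mem_union_right _ ?_
        simp only [Finset.mem_biUnion, Finset.mem_univ, Finset.mem_filter, true_and]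
        exact ⟨i, j, hji.symm, hi, hj⟩
      · push Not at h
        refine Finset.mem_union_left _ ?_
        simp only [Finset.mem_univ, Finset.mem_filter, true_and]
        exact fun i => hdense i v (h i)
    refine (Finset.card_le_card hsub).trans ((Finset.card_union_le _ _).trans ?_)
    refine Nat.add_le_add ?_ ?_
    · exact (hI.card_dense_lt hK hN1 hmax).le.trans (Nat.choose_le_choose _ (by omega))
    · refine (Finset.card_biUnion_le_card_mul _ _ (p * (K + L).choose K) ?_).trans
        (Nat.mul_le_mul_right _ (by simpa using hmp))
      intro i _
      refine (Finset.card_biUnion_le_card_mul _ _ ((K + L).choose K) ?_).trans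
        (Nat.mul_le_mul_right _ (by simpa using hmp))
      intro j _
      by_cases hij : i = j
      · simp [hij]
      · simp only [ne_eq, hij, not_false_eq_true, true_and]
        exact (hI.card_sparse_two_lt hK hs hL (by omega) hij).le
  · intro v i hvi
    obtain ⟨i', rfl, hi', hu⟩ := hf v i hvi
    refine ⟨?_, ?_⟩
    · refine le_trans (Finset.card_le_card ?_) (hs.card_adj_sparse_lt hK (hI.2.1 i')
        (hN2.trans (hI.1 i')) hi').le
      intro w hw
      simp only [Finset.mem_univ, Finset.mem_filter, true_and] at hw ⊢
      obtain ⟨j, hj, hj', -⟩ := hf w _ hw.1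
      obtain rfl := Fin.castLE_injective hmp hj
      exact ⟨hj', hw.2⟩
    · intro j hji
      -- Indices `j ≥ m` label empty classes.
      by_cases hj0 : ∃ j' : Fin m, Fin.castLE hmp j' = j
      · obtain ⟨j', rfl⟩ := hj0
        have hnj : ¬ sp j' v := fun h => hji (by rw [hu _ h])
        refine le_trans (Finset.card_le_card ?_) (hs.card_not_adj_sparse_lt hK (hI.2.1 j')
          (hN2.trans (hI.1 j')) (hdense _ _ hnj)).le
        intro w hw
        simp only [Finset.mem_univ, Finset.mem_filter, true_and] at hw ⊢
        obtain ⟨l, hl, hl', -⟩ := hf w _ hw.1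
        obtain rfl := Fin.castLE_injective hmp hl
        exact ⟨hl', hw.2⟩
      · rw [Finset.card_eq_zero.mpr]
        · exact Nat.zero_le _
        · rw [Finset.filter_eq_empty_iff]
          rintro w - ⟨hw, -⟩
          obtain ⟨l, hl, -⟩ := hf w _ hw
          exact hj0 ⟨l, hl⟩

/-! ### Quadratic forms, operator norms and Bessel's inequality. -/

open Matrix

theorem dotProduct_mulVec_comm_of_isSymm {V : Type*} [Fintype V] {M : Matrix V V ℝ}
    (hM : M.IsSymm) (x y : V → ℝ) : x ⬝ᵥ M *ᵥ y = M *ᵥ x ⬝ᵥ y := by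
  rw [Matrix.dotProduct_mulVec, ← Matrix.mulVec_transpose, hM.eq]

theorem dotProduct_abs_self {V : Type*} [Fintype V] (x : V → ℝ) : |x| ⬝ᵥ |x| = x ⬝ᵥ x := by
  simp [dotProduct]

theorem abs_dotProduct_mulVec_le {V : Type*} [Fintype V] {M : Matrix V V ℝ}
    (h0 : ∀ u w, 0 ≤ M u w) (x y : V → ℝ) : |x ⬝ᵥ M *ᵥ y| ≤ |x| ⬝ᵥ M *ᵥ |y| := by
  simp only [dotProduct, mulVec, Pi.abs_apply]
  refine (Finset.abs_sum_le_sum_abs _ _).trans (Finset.sum_le_sum fun u _ => ?_)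
  rw [abs_mul]
  refine mul_le_mul_of_nonneg_left ((Finset.abs_sum_le_sum_abs _ _).trans
    (Finset.sum_le_sum fun w _ => ?_)) (abs_nonneg _)
  rw [abs_mul, abs_of_nonneg (h0 u w)]

/-- For a symmetric matrix with nonnegative entries, an upper bound for the quadratic form bounds
the operator norm. -/
theorem mulVec_dotProduct_self_le {V : Type*} [Fintype V] {M : Matrix V V ℝ} (hM : M.IsSymm)
    (h0 : ∀ u w, 0 ≤ M u w) {c : ℝ} (hc : 0 < c)
    (hq : ∀ y : V → ℝ, y ⬝ᵥ M *ᵥ y ≤ c * (y ⬝ᵥ y)) (x : V → ℝ) :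
    M *ᵥ x ⬝ᵥ M *ᵥ x ≤ c ^ 2 * (x ⬝ᵥ x) := by
  set y := M *ᵥ x with hy
  have hq' : ∀ z : V → ℝ, -(c * (z ⬝ᵥ z)) ≤ z ⬝ᵥ M *ᵥ z := by
    intro z
    have h1 := (abs_le.mp (abs_dotProduct_mulVec_le h0 z z)).1
    have h2 := hq |z|
    rw [dotProduct_abs_self] at h2
    linarith
  -- Polarisation: the difference of the forms at `x ± c⁻¹ • y` is `4 * c⁻¹ * (y ⬝ᵥ y)`.
  have h1 := hq (x + c⁻¹ • y)
  have h2 := hq' (x - c⁻¹ • y)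
  have hxy : x ⬝ᵥ M *ᵥ y = y ⬝ᵥ y := by rw [dotProduct_mulVec_comm_of_isSymm hM]
  have hyx : y ⬝ᵥ M *ᵥ x = y ⬝ᵥ y := by rw [← hy]
  have hcomm : y ⬝ᵥ x = x ⬝ᵥ y := dotProduct_comm _ _
  simp only [mulVec_add, mulVec_sub, mulVec_smul, add_dotProduct, sub_dotProduct, dotProduct_add,
    dotProduct_sub, smul_dotProduct, dotProduct_smul, smul_eq_mul, hxy, hyx, hcomm] at h1 h2
  have h3 : 2 * c⁻¹ * (y ⬝ᵥ y) ≤ c * (x ⬝ᵥ x) + c * (c⁻¹ * (c⁻¹ * (y ⬝ᵥ y))) := by linarith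
  have h4 : c * (c⁻¹ * (c⁻¹ * (y ⬝ᵥ y))) = c⁻¹ * (y ⬝ᵥ y) := by field_simp
  rw [h4] at h3
  have h5 : c⁻¹ * (y ⬝ᵥ y) ≤ c * (x ⬝ᵥ x) := by linarith
  have h6 := mul_le_mul_of_nonneg_left h5 hc.le
  rw [← mul_assoc, mul_inv_cancel₀ hc.ne', one_mul] at h6
  nlinarith

open scoped Classical in
theorem pow_mulVec_dotProduct_self_le {V : Type*} [Fintype V] {M : Matrix V V ℝ} {c : ℝ}
    (hM : ∀ x : V → ℝ, M *ᵥ x ⬝ᵥ M *ᵥ x ≤ c ^ 2 * (x ⬝ᵥ x)) (t : ℕ) (x : V → ℝ) :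
    (M ^ t) *ᵥ x ⬝ᵥ (M ^ t) *ᵥ x ≤ c ^ (2 * t) * (x ⬝ᵥ x) := by
  induction t with
  | zero => simp
  | succ t ih =>
    rw [pow_succ', ← Matrix.mulVec_mulVec]
    refine (hM _).trans ((mul_le_mul_of_nonneg_left ih (sq_nonneg c)).trans (le_of_eq ?_))
    ring

/-- Each prescribed zero costs at most one dimension. -/
theorem card_le_add_finrank {V : Type*} [Fintype V] (K : Submodule ℝ (V → ℝ)) (Z : Finset V)
    (W : Submodule ℝ (V → ℝ)) (hW : ∀ y ∈ K, (∀ z ∈ Z, y z = 0) → y ∈ W) :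
    Module.finrank ℝ K ≤ Z.card + Module.finrank ℝ W := by
  let φ : K →ₗ[ℝ] (Z → ℝ) := (LinearMap.funLeft ℝ ℝ (fun z : Z => (z : V))).comp K.subtype
  have h1 := φ.finrank_range_add_finrank_ker
  have h2 : Module.finrank ℝ (LinearMap.range φ) ≤ Z.card := by
    refine (Submodule.finrank_le _).trans ?_
    simp
  have h3 : Module.finrank ℝ (LinearMap.ker φ) ≤ Module.finrank ℝ W := by
    let ψ : LinearMap.ker φ →ₗ[ℝ] W := LinearMap.codRestrict W
      (K.subtype.comp (LinearMap.ker φ).subtype) (by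
        intro y
        refine hW _ y.1.2 fun z hz => ?_
        exact congrFun (LinearMap.mem_ker.mp y.2) ⟨z, hz⟩)
    refine LinearMap.finrank_le_finrank_of_injective (f := ψ) ?_
    intro a b hab
    have h : ((a : K) : V → ℝ) = ((b : K) : V → ℝ) := congrArg (fun y : W => (y : V → ℝ)) hab
    exact Subtype.ext (Subtype.ext h)
  omega

/-- Orthonormal families in subspaces of `V → ℝ`, with Bessel's inequality. -/
theorem exists_orthonormal_bessel {V : Type*} [Fintype V] (W : Submodule ℝ (V → ℝ)) :
    ∃ w : Fin (Module.finrank ℝ W) → V → ℝ, (∀ i, w i ∈ W) ∧ (∀ i, w i ⬝ᵥ w i = 1) ∧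
      ∀ x : V → ℝ, ∑ i, (x ⬝ᵥ w i) ^ 2 ≤ x ⬝ᵥ x := by
  let e := (WithLp.linearEquiv 2 ℝ (V → ℝ)).symm
  let W' : Submodule ℝ (EuclideanSpace ℝ V) := W.map e.toLinearMap
  have hfr : Module.finrank ℝ W' = Module.finrank ℝ W := e.finrank_map_eq W
  let b := (stdOrthonormalBasis ℝ W').reindex (finCongr hfr)
  have hin : ∀ x y : EuclideanSpace ℝ V, inner ℝ x y = x.ofLp ⬝ᵥ y.ofLp := by
    intro x y
    simp [PiLp.inner_apply, dotProduct, mul_comm]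
  have hortho : Orthonormal ℝ (fun i => (b i : EuclideanSpace ℝ V)) :=
    b.orthonormal.comp_linearIsometry W'.subtypeₗᵢ
  refine ⟨fun i => (b i : EuclideanSpace ℝ V).ofLp, ?_, ?_, ?_⟩
  · intro i
    obtain ⟨y, hy, hyb⟩ := (Submodule.mem_map.mp (b i).2)
    show (b i : EuclideanSpace ℝ V).ofLp ∈ W
    rw [← hyb]
    exact hy
  · intro i
    rw [← hin, real_inner_self_eq_norm_sq, hortho.1 i, one_pow]
  · intro x
    have h := hortho.sum_inner_products_le (e x) (s := Finset.univ)
    rw [← real_inner_self_eq_norm_sq, hin] at h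
    refine le_trans (le_of_eq (Finset.sum_congr rfl fun i _ => ?_)) h
    rw [hin, Real.norm_eq_abs, sq_abs, dotProduct_comm]
    rfl

/-! ### Balls, deleted vertices and the loss of closed walks. -/

open scoped Classical in
/-- The adjacency matrix of `H` with all edges outside `S` deleted. -/
noncomputable def restrAdj {V : Type*} (H : SimpleGraph V) (S : Set V) : Matrix V V ℝ :=
  Matrix.of fun u w => if H.Adj u w ∧ u ∈ S ∧ w ∈ S then 1 else 0

/-- The ball of radius `r` around `v`. -/
def walkBall {V : Type*} (H : SimpleGraph V) (v : V) (r : ℕ) : Set V :=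
  {w | ∃ p : H.Walk v w, p.length ≤ r}

/-- Some walk of length at most `t` leads from the given vertex into `Z`. -/
def IsNear {V : Type*} (H : SimpleGraph V) (Z : Set V) : ℕ → V → Prop
  | 0, u => u ∈ Z
  | t + 1, u => u ∈ Z ∨ ∃ w, H.Adj u w ∧ IsNear H Z t w

theorem IsNear.succ {V : Type*} {H : SimpleGraph V} {Z : Set V} {t : ℕ} {u : V}
    (h : IsNear H Z t u) : IsNear H Z (t + 1) u := by
  induction t generalizing u with
  | zero => exact Or.inl h
  | succ t ih =>
    rcases h with h | ⟨w, hw, h⟩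
    · exact Or.inl h
    · exact Or.inr ⟨w, hw, ih h⟩

theorem IsNear.mono {V : Type*} {H : SimpleGraph V} {Z : Set V} {s t : ℕ} (hst : s ≤ t) {u : V}
    (h : IsNear H Z s u) : IsNear H Z t u := by
  induction hst with
  | refl => exact h
  | step _ ih => exact ih.succ

theorem mem_walkBall_self {V : Type*} (H : SimpleGraph V) (v : V) (r : ℕ) : v ∈ walkBall H v r :=
  ⟨SimpleGraph.Walk.nil, by simp⟩

theorem walkBall_mono {V : Type*} (H : SimpleGraph V) (v : V) {r s : ℕ} (h : r ≤ s) :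
    walkBall H v r ⊆ walkBall H v s := fun _ ⟨p, hp⟩ => ⟨p, hp.trans h⟩

theorem mem_walkBall_of_adj {V : Type*} {H : SimpleGraph V} {v u w : V} {r : ℕ}
    (hu : u ∈ walkBall H v r) (h : H.Adj u w) : w ∈ walkBall H v (r + 1) := by
  obtain ⟨p, hp⟩ := hu
  exact ⟨p.concat h, by simpa using hp⟩

section restrAdj

variable {V : Type*} {H : SimpleGraph V} {S T : Set V}

theorem restrAdj_isSymm (H : SimpleGraph V) (S : Set V) : (restrAdj H S).IsSymm := by
  ext u w
  simp only [restrAdj, transpose_apply, of_apply, H.adj_comm]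
  congr 1
  simp only [eq_iff_iff]
  tauto

theorem restrAdj_nonneg (u w : V) : 0 ≤ restrAdj H S u w := by
  simp only [restrAdj, of_apply]
  split_ifs <;> norm_num

theorem restrAdj_mono (h : S ⊆ T) (u w : V) : restrAdj H S u w ≤ restrAdj H T u w := by
  simp only [restrAdj, of_apply]
  split_ifs with h1 h2
  · exact le_rfl
  · exact absurd ⟨h1.1, h h1.2.1, h h1.2.2⟩ h2
  · norm_num
  · exact le_rfl

theorem restrAdj_eq_one {u w : V} (h : H.Adj u w) (hu : u ∈ S) (hw : w ∈ S) :
    restrAdj H S u w = 1 := by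
  simp [restrAdj, h, hu, hw]

theorem restrAdj_eq_zero_left {u w : V} (hu : u ∉ S) : restrAdj H S u w = 0 := by
  simp [restrAdj, hu]

theorem restrAdj_eq_zero_right {u w : V} (hw : w ∉ S) : restrAdj H S u w = 0 := by
  simp [restrAdj, hw]

end restrAdj

open scoped Classical in
theorem pow_entry_nonneg {V : Type*} [Fintype V] {M : Matrix V V ℝ} (h0 : ∀ u w, 0 ≤ M u w)
    (n : ℕ) (u w : V) : 0 ≤ (M ^ n) u w := by
  induction n generalizing u w with
  | zero => rw [pow_zero, one_apply]; split_ifs <;> norm_num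
  | succ n ih =>
    rw [pow_succ, mul_apply]
    exact Finset.sum_nonneg fun a _ => mul_nonneg (ih _ _) (h0 _ _)

open scoped Classical in
theorem pow_entry_mono {V : Type*} [Fintype V] {M N : Matrix V V ℝ} (h0 : ∀ u w, 0 ≤ N u w)
    (h : ∀ u w, N u w ≤ M u w) (n : ℕ) (u w : V) : (N ^ n) u w ≤ (M ^ n) u w := by
  induction n generalizing u w with
  | zero => simp
  | succ n ih =>
    rw [pow_succ, pow_succ, mul_apply, mul_apply]
    exact Finset.sum_le_sum fun a _ => mul_le_mul (ih _ _) (h _ _) (h0 _ _)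
      ((pow_entry_nonneg h0 _ _ _).trans (ih _ _))

theorem mulVec_nonneg_of_nonneg {V : Type*} [Fintype V] {M : Matrix V V ℝ}
    (h0 : ∀ u w, 0 ≤ M u w) {x : V → ℝ} (hx : ∀ v, 0 ≤ x v) (v : V) : 0 ≤ (M *ᵥ x) v :=
  Finset.sum_nonneg fun _ _ => mul_nonneg (h0 _ _) (hx _)

-- The walk going back and forth along the edge is closed.
open scoped Classical in
theorem one_le_even_pow_restrAdj {V : Type*} [Fintype V] {H : SimpleGraph V} {S : Set V} {u w : V}
    (h : H.Adj u w) (hu : u ∈ S) (hw : w ∈ S) (t : ℕ) : 1 ≤ ((restrAdj H S) ^ (2 * t)) w w := by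
  induction t with
  | zero => simp
  | succ t ih =>
    have h2 : 1 ≤ ((restrAdj H S) ^ 2) w w := by
      rw [pow_two, mul_apply]
      refine le_trans (le_of_eq ?_) (Finset.single_le_sum
        (fun a _ => mul_nonneg (restrAdj_nonneg _ _) (restrAdj_nonneg _ _)) (Finset.mem_univ u))
      rw [restrAdj_eq_one h.symm hw hu, restrAdj_eq_one h hu hw, one_mul]
    rw [Nat.mul_succ, pow_add, mul_apply]
    refine le_trans ?_ (Finset.single_le_sum
      (fun a _ => mul_nonneg (pow_entry_nonneg restrAdj_nonneg _ _ _)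
        (pow_entry_nonneg restrAdj_nonneg _ _ _)) (Finset.mem_univ w))
    exact one_le_mul_of_one_le_of_one_le ih h2

open scoped Classical in
/-- Deleting a set within distance `t` of `u` destroys a closed walk of length `2 * t` at `u`. -/
theorem even_pow_restrAdj_add_one_le {V : Type*} [Fintype V] {H : SimpleGraph V} {v : V}
    {b Z : Set V} {R : ℕ} (hb : b ⊆ walkBall H v R) (hbZ : ∀ u ∈ b, u ∉ Z) (t : ℕ) (r : ℕ)
    (hr : r + t ≤ R) (u : V) (hu : u ∈ walkBall H v r) (huZ : u ∉ Z) (hn : IsNear H Z t u) :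
    ((restrAdj H b) ^ (2 * t)) u u + 1 ≤ ((restrAdj H (walkBall H v R)) ^ (2 * t)) u u := by
  induction t generalizing r u with
  | zero => exact absurd hn huZ
  | succ t ih =>
    rcases hn with hn | ⟨w, huw, hw⟩
    · exact absurd hn huZ
    set N := restrAdj H b with hN
    set M := restrAdj H (walkBall H v R) with hM
    have hNM : ∀ x y, N x y ≤ M x y := restrAdj_mono hb
    have hN0 : ∀ x y, 0 ≤ N x y := restrAdj_nonneg
    have hM0 : ∀ x y, 0 ≤ M x y := restrAdj_nonneg
    have hwr : w ∈ walkBall H v (r + 1) := mem_walkBall_of_adj hu huw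
    have huR : u ∈ walkBall H v R := walkBall_mono H v (by omega) hu
    have hwR : w ∈ walkBall H v R := walkBall_mono H v (by omega) hwr
    -- Split off the first and last edges; the term with both inner ends equal to `w` will supply
    -- the gain.
    have hexp : ∀ X : Matrix V V ℝ, (X ^ (2 * (t + 1))) u u =
        ∑ q : V × V, X u q.1 * (X ^ (2 * t)) q.1 q.2 * X q.2 u := by
      intro X
      rw [show 2 * (t + 1) = 1 + 2 * t + 1 by ring, pow_succ, pow_add, pow_one, mul_apply,
        Fintype.sum_prod_type_right]
      refine Finset.sum_congr rfl fun y _ => ?_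
      rw [mul_apply, Finset.sum_mul]
    rw [hexp, hexp]
    have hle : ∀ q : V × V, N u q.1 * (N ^ (2 * t)) q.1 q.2 * N q.2 u ≤
        M u q.1 * (M ^ (2 * t)) q.1 q.2 * M q.2 u := fun q =>
      mul_le_mul (mul_le_mul (hNM _ _) (pow_entry_mono hN0 hNM _ _ _)
        (pow_entry_nonneg hN0 _ _ _) (hM0 _ _)) (hNM _ _) (hN0 _ _)
        (mul_nonneg (hM0 _ _) (pow_entry_nonneg hM0 _ _ _))
    have hgain : N u w * (N ^ (2 * t)) w w * N w u + 1 ≤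
        M u w * (M ^ (2 * t)) w w * M w u := by
      rw [hM, restrAdj_eq_one huw huR hwR, restrAdj_eq_one huw.symm hwR huR, ← hM, one_mul, mul_one]
      -- If `w` is deleted, the smaller graph loses this term entirely, while the larger one still
      -- has the back-and-forth walk. Otherwise the gain comes from `w`, one step closer to `Z`.
      by_cases hwZ : w ∈ Z
      · have : N u w = 0 := restrAdj_eq_zero_right fun h => hbZ w h hwZ
        rw [this, zero_mul, zero_mul, zero_add]
        exact one_le_even_pow_restrAdj huw huR hwR t
      · have h1 := ih (r + 1) (by omega) w hwr hwZ hw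
        have h2 : N u w * (N ^ (2 * t)) w w * N w u ≤ 1 * (N ^ (2 * t)) w w * 1 := by
          have e1 : N u w ≤ 1 := (hNM _ _).trans_eq (restrAdj_eq_one huw huR hwR)
          have e2 : N w u ≤ 1 := (hNM _ _).trans_eq (restrAdj_eq_one huw.symm hwR huR)
          exact mul_le_mul (mul_le_mul_of_nonneg_right e1 (pow_entry_nonneg hN0 _ _ _)) e2
            (hN0 _ _) (mul_nonneg zero_le_one (pow_entry_nonneg hN0 _ _ _))
        linarith
    rw [← Finset.add_sum_erase _ _ (Finset.mem_univ (w, w)),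
      ← Finset.add_sum_erase _ (fun q : V × V => M u q.1 * (M ^ (2 * t)) q.1 q.2 * M q.2 u)
        (Finset.mem_univ (w, w))]
    have := Finset.sum_le_sum (s := Finset.univ.erase (w, w)) (fun q _ => hle q)
    simp only at this ⊢
    linarith

open scoped Classical in
theorem pow_mulVec_dotProduct_self_eq {V : Type*} [Fintype V] {M : Matrix V V ℝ} (hM : M.IsSymm)
    (t : ℕ) (x : V → ℝ) :
    (M ^ t) *ᵥ x ⬝ᵥ (M ^ t) *ᵥ x = ∑ u, ∑ w, x u * (M ^ (2 * t)) u w * x w := by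
  have hs : (M ^ t).IsSymm := hM.pow t
  rw [← dotProduct_mulVec_comm_of_isSymm hs, mulVec_mulVec, ← pow_add, ← two_mul]
  simp only [dotProduct, mulVec, Finset.mul_sum, mul_assoc]

-- The gain is needed only on the diagonal: since `x` is nonnegative, entrywise monotonicity handles
-- the other terms.
open scoped Classical in
theorem pow_mulVec_add_le {V : Type*} [Fintype V] {M N : Matrix V V ℝ} (hM : M.IsSymm)
    (hN : N.IsSymm) (hN0 : ∀ u w, 0 ≤ N u w) (hNM : ∀ u w, N u w ≤ M u w) {t : ℕ} {b : Set V}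
    (hgain : ∀ u ∈ b, (N ^ (2 * t)) u u + 1 ≤ (M ^ (2 * t)) u u) {x : V → ℝ}
    (hx : ∀ v, 0 ≤ x v) (hxb : ∀ v, v ∉ b → x v = 0) :
    (N ^ t) *ᵥ x ⬝ᵥ (N ^ t) *ᵥ x + x ⬝ᵥ x ≤ (M ^ t) *ᵥ x ⬝ᵥ (M ^ t) *ᵥ x := by
  rw [pow_mulVec_dotProduct_self_eq hM, pow_mulVec_dotProduct_self_eq hN, dotProduct,
    ← Finset.sum_add_distrib]
  refine Finset.sum_le_sum fun u _ => ?_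
  have hle : ∀ w, x u * (N ^ (2 * t)) u w * x w ≤ x u * (M ^ (2 * t)) u w * x w := fun w =>
    mul_le_mul_of_nonneg_right (mul_le_mul_of_nonneg_left (pow_entry_mono hN0 hNM _ _ _) (hx u))
      (hx w)
  by_cases hu : u ∈ b
  · rw [← Finset.add_sum_erase _ _ (Finset.mem_univ u),
      ← Finset.add_sum_erase _ (fun w => x u * (M ^ (2 * t)) u w * x w) (Finset.mem_univ u)]
    have h1 := Finset.sum_le_sum (s := Finset.univ.erase u) (fun w _ => hle w)
    have h2 := mul_le_mul_of_nonneg_left (hgain u hu) (mul_nonneg (hx u) (hx u))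
    linarith
  · rw [hxb u hu, zero_mul, add_zero]
    have := Finset.sum_le_sum (s := Finset.univ) (fun w _ => hle w)
    rwa [hxb u hu] at this

open scoped Classical in
/-- Powers of the adjacency matrix decay geometrically away from a set close to every vertex. -/
theorem pow_mul_mulVec_dotProduct_self_le {V : Type*} [Fintype V] {M N : Matrix V V ℝ}
    (hM : M.IsSymm) (hN : N.IsSymm) (hN0 : ∀ u w, 0 ≤ N u w) (hNM : ∀ u w, N u w ≤ M u w)
    {t : ℕ} {b : Set V} (hNb : ∀ u w, u ∉ b → N u w = 0)
    (hgain : ∀ u ∈ b, (N ^ (2 * t)) u u + 1 ≤ (M ^ (2 * t)) u u) {c : ℝ}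
    (hMc : ∀ x : V → ℝ, M *ᵥ x ⬝ᵥ M *ᵥ x ≤ c ^ 2 * (x ⬝ᵥ x)) {θ : ℝ} (hθ0 : 0 ≤ θ)
    (hθ : c ^ (2 * t) - 1 ≤ θ) {x : V → ℝ}
    (hx : ∀ v, 0 ≤ x v) (hxb : ∀ v, v ∉ b → x v = 0) (s : ℕ) :
    (N ^ (t * s)) *ᵥ x ⬝ᵥ (N ^ (t * s)) *ᵥ x ≤ θ ^ s * (x ⬝ᵥ x) := by
  induction s with
  | zero => simp
  | succ s ih =>
    set y := (N ^ (t * s)) *ᵥ x with hy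
    have hy0 : ∀ v, 0 ≤ y v := mulVec_nonneg_of_nonneg (pow_entry_nonneg hN0 _) hx
    have hyb : ∀ v, v ∉ b → y v = 0 := by
      intro v hv
      rcases h : t * s with _ | n
      · simpa [hy, h] using hxb v hv
      · rw [hy, h, pow_succ', ← mulVec_mulVec]
        exact Finset.sum_eq_zero fun w _ => by
          change N v w * _ = 0
          rw [hNb v w hv, zero_mul]
    have h1 := pow_mulVec_add_le hM hN hN0 hNM hgain hy0 hyb
    have h2 := pow_mulVec_dotProduct_self_le hMc t y
    rw [Nat.mul_succ, add_comm, pow_add, ← mulVec_mulVec, ← hy]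
    have h3 : 0 ≤ y ⬝ᵥ y := Finset.sum_nonneg fun v _ => mul_self_nonneg _
    calc (N ^ t) *ᵥ y ⬝ᵥ (N ^ t) *ᵥ y ≤ (c ^ (2 * t) - 1) * (y ⬝ᵥ y) := by linarith
      _ ≤ θ * (y ⬝ᵥ y) := mul_le_mul_of_nonneg_right hθ h3
      _ ≤ θ * (θ ^ s * (x ⬝ᵥ x)) := mul_le_mul_of_nonneg_left ih hθ0
      _ = θ ^ (s + 1) * (x ⬝ᵥ x) := by ring

-- Walks of length `n` from `v` never leave the ball of radius `n`, so globally deleting `Z` can be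
-- studied inside a ball.
open scoped Classical in
theorem pow_restrAdj_mulVec_single {V : Type*} [Fintype V] {H : SimpleGraph V} {Z : Set V} {v : V}
    (hv : v ∉ Z) {R n : ℕ} (hn : n ≤ R) :
    ((restrAdj H Zᶜ) ^ n) *ᵥ Pi.single v 1 =
      ((restrAdj H (walkBall H v R \ Z)) ^ n) *ᵥ Pi.single v 1 ∧
    ∀ w, w ∉ walkBall H v n \ Z → (((restrAdj H Zᶜ) ^ n) *ᵥ Pi.single v (1 : ℝ)) w = 0 := by
  induction n with
  | zero =>
    refine ⟨by simp, fun w hw => ?_⟩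
    have : w ≠ v := by
      rintro rfl
      exact hw ⟨mem_walkBall_self _ _ _, hv⟩
    simp [this]
  | succ n ih =>
    obtain ⟨h1, h2⟩ := ih (by omega)
    set x := ((restrAdj H Zᶜ) ^ n) *ᵥ Pi.single v (1 : ℝ) with hx
    constructor
    · rw [pow_succ', pow_succ', ← mulVec_mulVec, ← mulVec_mulVec, ← h1, ← hx]
      ext u
      refine Finset.sum_congr rfl fun w _ => ?_
      change restrAdj H Zᶜ u w * x w = restrAdj H _ u w * x w
      by_cases hw : w ∈ walkBall H v n \ Z
      · congr 1
        by_cases huw : H.Adj u w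
        · have hu : u ∈ walkBall H v R :=
            walkBall_mono _ _ hn (mem_walkBall_of_adj hw.1 huw.symm)
          have hw' : w ∈ walkBall H v R := walkBall_mono _ _ (by omega) hw.1
          simp [restrAdj, huw, hu, hw']
        · simp [restrAdj, huw]
      · rw [h2 w hw, mul_zero, mul_zero]
    · intro u hu
      rw [pow_succ', ← mulVec_mulVec, ← hx]
      refine Finset.sum_eq_zero fun w _ => ?_
      change restrAdj H Zᶜ u w * x w = 0
      by_cases hw : w ∈ walkBall H v n \ Z
      · by_cases huw : H.Adj u w
        · have : u ∈ Z := by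
            by_contra h
            exact hu ⟨mem_walkBall_of_adj hw.1 huw.symm, h⟩
          simp [restrAdj, this]
        · simp [restrAdj, huw]
      · rw [h2 w hw, mul_zero]

/-! ### Decay against eigenvectors, and Perron–Frobenius. -/

/-- Some vector supported on `S` has Rayleigh quotient above `c` for the adjacency matrix. -/
def ExceedsOn {V : Type*} [Fintype V] (H : SimpleGraph V) (c : ℝ) (S : Set V) : Prop :=
  ∃ y : V → ℝ, (∀ v, v ∉ S → y v = 0) ∧ c * (y ⬝ᵥ y) < y ⬝ᵥ restrAdj H Set.univ *ᵥ y

theorem dotProduct_restrAdj_mulVec_le {V : Type*} [Fintype V] {H : SimpleGraph V} {c : ℝ}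
    (hc : 0 < c) {S : Set V} (h : ¬ ExceedsOn H c S) (y : V → ℝ) :
    y ⬝ᵥ restrAdj H S *ᵥ y ≤ c * (y ⬝ᵥ y) := by
  classical
  set z : V → ℝ := fun v => if v ∈ S then y v else 0 with hz
  have h1 : z ⬝ᵥ restrAdj H Set.univ *ᵥ z ≤ c * (z ⬝ᵥ z) := by
    by_contra! hlt
    exact h ⟨z, fun v hv => by simp [hz, hv], hlt⟩
  have h2 : z ⬝ᵥ restrAdj H Set.univ *ᵥ z = y ⬝ᵥ restrAdj H S *ᵥ y := by
    simp only [dotProduct, mulVec, Finset.mul_sum]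
    refine Finset.sum_congr rfl fun u _ => Finset.sum_congr rfl fun w _ => ?_
    by_cases hu : u ∈ S <;> by_cases hw : w ∈ S <;> simp [hz, restrAdj, hu, hw]
  have h3 : z ⬝ᵥ z ≤ y ⬝ᵥ y := by
    refine Finset.sum_le_sum fun u _ => ?_
    by_cases hu : u ∈ S
    · simp [hz, hu]
    · simp [hz, hu, mul_self_nonneg]
  rw [← h2]
  exact h1.trans (mul_le_mul_of_nonneg_left h3 hc.le)

/-- A trace estimate. Vectors of `W` vanish on `Z`, so they stay eigenvectors after `Z` is deleted.
For an orthonormal family in `W`, Bessel bounds the sum of `(c ^ n * w i v) ^ 2` over `i` by the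
squared norm of the `n`-th power applied to the unit vector at `v`, which decays. Summing over `v`
recovers the dimension. -/
theorem finrank_mul_pow_le {V : Type*} [Fintype V] {H : SimpleGraph V} {c : ℝ} (hc : 0 < c)
    (W : Submodule ℝ (V → ℝ)) (Z X : Set V) (B : Finset V) {t s : ℕ}
    (hB : ∀ v, v ∈ X → v ∉ Z → v ∈ B)
    (hWe : ∀ y ∈ W, restrAdj H Set.univ *ᵥ y = c • y) (hWZ : ∀ y ∈ W, ∀ v ∈ Z, y v = 0)
    (hWX : ∀ y ∈ W, ∀ v, v ∉ X → y v = 0)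
    (hX : ∀ v ∈ X, v ∉ Z → ¬ ExceedsOn H c (walkBall H v (t * s + t)) ∧
      ∀ u ∈ walkBall H v (t * s), IsNear H Z t u)
    {θ : ℝ} (hθ0 : 0 ≤ θ) (hθ : c ^ (2 * t) - 1 ≤ θ) :
    (Module.finrank ℝ W : ℝ) * c ^ (2 * (t * s)) ≤ B.card * θ ^ s := by
  classical
  obtain ⟨w, hwW, hw1, hbes⟩ := exists_orthonormal_bessel W
  set A' := restrAdj H Zᶜ with hA'
  have hsym : ∀ n, (A' ^ n).IsSymm := fun n => (restrAdj_isSymm H _).pow n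
  have heig : ∀ y ∈ W, A' *ᵥ y = c • y := by
    intro y hy
    rw [← hWe y hy]
    ext u
    by_cases hu : u ∈ Z
    · have h1 : (restrAdj H Set.univ *ᵥ y) u = 0 := by
        rw [hWe y hy, Pi.smul_apply, hWZ y hy u hu, smul_zero]
      rw [h1]
      exact Finset.sum_eq_zero fun a _ => by
        change A' u a * _ = 0
        rw [hA', restrAdj_eq_zero_left (by simpa using hu), zero_mul]
    · refine Finset.sum_congr rfl fun a _ => ?_
      change A' u a * y a = restrAdj H Set.univ u a * y a
      by_cases ha : a ∈ Z
      · rw [hWZ y hy a ha, mul_zero, mul_zero]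
      · congr 1
        simp [hA', restrAdj, hu, ha]
  have heigpow : ∀ n, ∀ y ∈ W, (A' ^ n) *ᵥ y = c ^ n • y := by
    intro n y hy
    induction n with
    | zero => simp
    | succ n ih => rw [pow_succ', ← mulVec_mulVec, ih, mulVec_smul, heig y hy, smul_smul, pow_succ]
  set n := t * s with hn
  have hinner : ∀ v i, ((A' ^ n) *ᵥ Pi.single v 1) ⬝ᵥ w i = c ^ n * w i v := by
    intro v i
    rw [← dotProduct_mulVec_comm_of_isSymm (hsym n), heigpow n _ (hwW i)]
    simp
  -- With `n = t * s`, the walks stay in the ball of radius `n`; the extra `t` leaves room for the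
  -- detours to `Z` that produce the gain, and there the norm is still at most `c`.
  have hdecay : ∀ v ∈ X, v ∉ Z →
      ((A' ^ n) *ᵥ Pi.single v 1) ⬝ᵥ ((A' ^ n) *ᵥ Pi.single v (1 : ℝ)) ≤ θ ^ s := by
    intro v hv hvZ
    obtain ⟨hne, hnear⟩ := hX v hv hvZ
    rw [hA', (pow_restrAdj_mulVec_single hvZ (le_refl n)).1]
    have hsub : walkBall H v n \ Z ⊆ walkBall H v (n + t) :=
      fun u hu => walkBall_mono _ _ (by omega) hu.1
    have := pow_mul_mulVec_dotProduct_self_le (M := restrAdj H (walkBall H v (n + t)))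
      (N := restrAdj H (walkBall H v n \ Z)) (t := t) (b := walkBall H v n \ Z)
      (restrAdj_isSymm _ _) (restrAdj_isSymm _ _)
      restrAdj_nonneg (restrAdj_mono hsub) (fun _ _ => restrAdj_eq_zero_left)
      (fun u hu => even_pow_restrAdj_add_one_le hsub (fun _ h => h.2) t n le_rfl u hu.1 hu.2
        (hnear u hu.1))
      (mulVec_dotProduct_self_le (restrAdj_isSymm _ _) restrAdj_nonneg hc
        (dotProduct_restrAdj_mulVec_le hc hne)) hθ0 hθ (x := Pi.single v 1)
      (fun u => by by_cases h : u = v <;> simp [h])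
      (fun u hu => by
        have : u ≠ v := by
          rintro rfl
          exact hu ⟨mem_walkBall_self _ _ _, hvZ⟩
        simp [this]) s
    simpa using this
  have hsum : ∀ i, ∑ v ∈ B, (c ^ n * w i v) ^ 2 = c ^ (2 * n) := by
    intro i
    have h1 : ∑ v ∈ B, (c ^ n * w i v) ^ 2 = ∑ v, (c ^ n * w i v) ^ 2 := by
      refine Finset.sum_subset (Finset.subset_univ _) fun v _ hv => ?_
      have : w i v = 0 := by
        by_contra h0
        exact hv (hB v (by_contra fun h => h0 (hWX _ (hwW i) v h))
          (fun h => h0 (hWZ _ (hwW i) v h)))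
      rw [this, mul_zero, zero_pow two_ne_zero]
    rw [h1]
    have h2 := hw1 i
    simp only [dotProduct] at h2
    calc ∑ v, (c ^ n * w i v) ^ 2 = c ^ (2 * n) * ∑ v, w i v * w i v := by
          rw [Finset.mul_sum]
          exact Finset.sum_congr rfl fun v _ => by ring
      _ = _ := by rw [h2, mul_one]
  calc (Module.finrank ℝ W : ℝ) * c ^ (2 * n)
      = ∑ i : Fin (Module.finrank ℝ W), ∑ v ∈ B, (c ^ n * w i v) ^ 2 := by
        simp [hsum]
    _ = ∑ v ∈ B, ∑ i, (c ^ n * w i v) ^ 2 := Finset.sum_comm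
    _ ≤ ∑ v ∈ B, θ ^ s := by
        refine Finset.sum_le_sum fun v _ => ?_
        by_cases hv : v ∈ X ∧ v ∉ Z
        · have h1 := hbes ((A' ^ n) *ᵥ Pi.single v 1)
          simp only [hinner] at h1
          exact h1.trans (hdecay v hv.1 hv.2)
        · have h0 : ∀ i, w i v = 0 := by
            intro i
            by_contra h0
            exact hv ⟨by_contra fun h => h0 (hWX _ (hwW i) v h),
              fun h => h0 (hWZ _ (hwW i) v h)⟩
          simp only [h0, mul_zero, ne_eq, OfNat.ofNat_ne_zero, not_false_eq_true, zero_pow,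
            Finset.sum_const_zero]
          positivity
    _ = B.card * θ ^ s := by simp

/-- Perron–Frobenius: on a component whose adjacency quadratic form is bounded by `c`, an
eigenvector for `c` vanishing at one vertex vanishes identically. -/
theorem eq_zero_on_component {V : Type*} [Fintype V] {H : SimpleGraph V} {c : ℝ} (hc : 0 < c)
    {C : H.ConnectedComponent} (hC : ¬ ExceedsOn H c C.supp) {y : V → ℝ}
    (hy : restrAdj H Set.univ *ᵥ y = c • y) {u : V} (hu : u ∈ C.supp) (hyu : y u = 0)
    {v : V} (hv : v ∈ C.supp) : y v = 0 := by
  classical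
  set A := restrAdj H Set.univ with hA
  have hsym : A.IsSymm := restrAdj_isSymm _ _
  have hadj : ∀ a b, A a b ≠ 0 → (a ∈ C.supp ↔ b ∈ C.supp) := by
    intro a b hab
    have : H.Adj a b := by
      by_contra h
      exact hab (by simp [hA, restrAdj, h])
    exact C.mem_supp_congr_adj this
  set y' : V → ℝ := fun v => if v ∈ C.supp then y v else 0 with hy'
  have hin : ∀ v, v ∈ C.supp → y' v = y v := fun v hv => if_pos hv
  have hout : ∀ v, v ∉ C.supp → y' v = 0 := fun v hv => if_neg hv
  have hy'e : A *ᵥ y' = c • y' := by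
    ext a
    by_cases ha : a ∈ C.supp
    · have h1 : (A *ᵥ y') a = (A *ᵥ y) a := by
        refine Finset.sum_congr rfl fun b _ => ?_
        change A a b * y' b = A a b * y b
        by_cases hab : A a b = 0
        · rw [hab, zero_mul, zero_mul]
        · rw [hin b ((hadj a b hab).mp ha)]
      rw [h1, hy, Pi.smul_apply, Pi.smul_apply, hin a ha]
    · rw [Pi.smul_apply, hout a ha, smul_zero]
      refine Finset.sum_eq_zero fun b _ => ?_
      change A a b * y' b = 0
      by_cases hab : A a b = 0
      · rw [hab, zero_mul]
      · have : b ∉ C.supp := fun hb => ha ((hadj a b hab).mpr hb)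
        rw [hout b this, mul_zero]
  set z : V → ℝ := |y'| with hz
  have hzC : ∀ v, v ∉ C.supp → z v = 0 := fun v hv => by simp [hz, hout v hv]
  have hub : ∀ x : V → ℝ, (∀ v, v ∉ C.supp → x v = 0) → x ⬝ᵥ A *ᵥ x ≤ c * (x ⬝ᵥ x) := by
    intro x hx
    by_contra! hlt
    exact hC ⟨x, hx, hlt⟩
  have hlow : c * (z ⬝ᵥ z) ≤ z ⬝ᵥ A *ᵥ z := by
    have h1 := abs_dotProduct_mulVec_le (M := A) restrAdj_nonneg y' y'
    rw [hz, dotProduct_abs_self]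
    refine le_trans ?_ ((le_abs_self _).trans h1)
    rw [hy'e, dotProduct_smul, smul_eq_mul]
  have hze : ∀ a ∈ C.supp, (A *ᵥ z) a = c * z a := by
    intro a ha
    set g := (A *ᵥ z) a - c * z a with hg
    -- First variation at a maximiser of the Rayleigh quotient. The step `g / c` turns the quadratic
    -- inequality into `2 * g ^ 2 / c ≤ g ^ 2 / c`, using that the diagonal of `A` is zero.
    have h1 := hub (z + (g / c) • Pi.single a 1) (by
      intro v hv
      have : v ≠ a := by
        rintro rfl
        exact hv ha
      simp [hzC v hv, this])
    have e1 : (Pi.single a 1 : V → ℝ) ⬝ᵥ A *ᵥ z = (A *ᵥ z) a := by simp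
    have e2 : z ⬝ᵥ A *ᵥ (Pi.single a 1) = (A *ᵥ z) a := by
      rw [dotProduct_mulVec_comm_of_isSymm hsym]
      simp
    have e3 : (Pi.single a 1 : V → ℝ) ⬝ᵥ A *ᵥ (Pi.single a 1) = 0 := by
      simp [hA, restrAdj]
    have e4 : (Pi.single a 1 : V → ℝ) ⬝ᵥ z = z a := by simp
    have e5 : z ⬝ᵥ (Pi.single a 1 : V → ℝ) = z a := by simp
    have e6 : (Pi.single a 1 : V → ℝ) ⬝ᵥ (Pi.single a 1 : V → ℝ) = 1 := by simp
    simp only [mulVec_add, mulVec_smul, add_dotProduct, dotProduct_add, smul_dotProduct,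
      dotProduct_smul, smul_eq_mul, e1, e2, e3, e4, e5, e6] at h1
    have h2 : 2 * (g / c) * g ≤ c * ((g / c) * (g / c)) := by
      rw [hg] at *
      linarith
    have h3 : c * ((g / c) * (g / c)) = g ^ 2 / c := by field_simp
    have h4 : 2 * (g / c) * g = 2 * (g ^ 2 / c) := by ring
    rw [h3, h4] at h2
    have h5 : g ^ 2 / c ≤ 0 := by linarith
    have h6 : g ^ 2 ≤ 0 := by
      by_contra! h
      exact absurd (div_pos h hc) (not_lt.mpr h5)
    have : g = 0 := by nlinarith [sq_nonneg g]
    linarith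
  have hz0 : ∀ a, 0 ≤ z a := fun a => abs_nonneg _
  -- At a zero of `z`, the eigenvalue equation says that a sum of nonnegative neighbour values
  -- vanishes.
  have hstep : ∀ a b, a ∈ C.supp → H.Adj a b → z a = 0 → z b = 0 := by
    intro a b ha hab hza
    have h1 := hze a ha
    rw [hza, mul_zero] at h1
    have h2 := (Finset.sum_eq_zero_iff_of_nonneg
      (fun d _ => mul_nonneg (restrAdj_nonneg a d) (hz0 d))).mp h1 b (Finset.mem_univ b)
    rwa [restrAdj_eq_one hab (Set.mem_univ _) (Set.mem_univ _), one_mul] at h2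
  have hzu : z u = 0 := by simp [hz, hin u hu, hyu]
  have hreach : H.Reachable u v := SimpleGraph.ConnectedComponent.exact
    ((C.mem_supp_iff u).mp hu |>.trans ((C.mem_supp_iff v).mp hv).symm)
  obtain ⟨p⟩ := hreach
  have hzv : z v = 0 := by
    clear hyu
    induction p with
    | nil => exact hzu
    | cons h p ih =>
      exact ih ((C.mem_supp_congr_adj h).mp hu) hv (hstep _ _ hu h hzu)
  simpa [hz, hin v hv] using hzv

/-! ### Components as graphs with a prescribed largest eigenvalue. -/

theorem mem_spectrum_iff_exists_mulVec_eq {n : Type*} [Fintype n] [DecidableEq n]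
    (A : Matrix n n ℝ) (c : ℝ) : c ∈ spectrum ℝ A ↔ ∃ x : n → ℝ, x ≠ 0 ∧ A *ᵥ x = c • x := by
  rw [spectrum.mem_iff, Matrix.isUnit_iff_isUnit_det, isUnit_iff_ne_zero, not_not,
    ← Matrix.exists_mulVec_eq_zero_iff]
  refine exists_congr fun x => and_congr_right fun _ => ?_
  rw [sub_mulVec, sub_eq_zero, Matrix.algebraMap_eq_diagonal]
  have : (diagonal (algebraMap ℝ (n → ℝ) c)) *ᵥ x = c • x := by
    ext i
    simp [mulVec_diagonal]
  rw [this, eq_comm]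

theorem isTopEigenvalue_iff {k : ℕ} (G : SimpleGraph (Fin k)) (c : ℝ) :
    IsTopEigenvalue G c ↔ IsGreatest (spectrum ℝ (restrAdj G Set.univ)) c := by
  classical
  have : restrAdj G Set.univ = G.adjMatrix ℝ := by
    ext u w
    simp [restrAdj, SimpleGraph.adjMatrix_apply]
  rw [this, IsTopEigenvalue]

open scoped Classical in
/-- A component on which `c` is an eigenvalue not exceeded by the quadratic form is a graph with
largest eigenvalue `c`. -/
theorem exists_isTopEigenvalue_of_component {V : Type*} [Fintype V] {H : SimpleGraph V} {c : ℝ}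
    {C : H.ConnectedComponent} (hC : ¬ ExceedsOn H c C.supp) {y : V → ℝ}
    (hy : restrAdj H Set.univ *ᵥ y = c • y) {u : V} (hu : u ∈ C.supp) (hyu : y u ≠ 0) :
    ∃ G : SimpleGraph (Fin (Finset.univ.filter (fun v => H.connectedComponentMk v = C)).card),
      IsTopEigenvalue G c := by
  set F := Finset.univ.filter (fun v => H.connectedComponentMk v = C) with hF
  have hmemF : ∀ v, v ∈ F ↔ v ∈ C.supp := fun v => by simp [hF]
  let e := F.equivFin.symm
  let f : Fin F.card → V := fun i => (e i : V)
  have hfC : ∀ i, f i ∈ C.supp := fun i => (hmemF _).mp (e i).2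
  have hsum : ∀ g : V → ℝ, ∑ i, g (f i) = ∑ v ∈ F, g v := by
    intro g
    rw [← Finset.sum_coe_sort F]
    exact Equiv.sum_comp e (fun v : F => g v)
  have hent : ∀ i j, restrAdj (H.comap f) Set.univ i j = restrAdj H Set.univ (f i) (f j) := by
    intro i j
    simp [restrAdj]
  have hout : ∀ v w, v ∈ C.supp → w ∉ F → restrAdj H Set.univ v w = 0 := by
    intro v w hv hw
    have : ¬ H.Adj v w := fun h => hw ((hmemF w).mpr ((C.mem_supp_congr_adj h).mp hv))
    simp [restrAdj, this]
  refine ⟨H.comap f, (isTopEigenvalue_iff _ _).mpr ⟨?_, ?_⟩⟩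
  · rw [mem_spectrum_iff_exists_mulVec_eq]
    refine ⟨y ∘ f, ?_, ?_⟩
    · intro h0
      apply hyu
      have := congrFun h0 (F.equivFin ⟨u, (hmemF u).mpr hu⟩)
      simpa [f, e] using this
    · ext i
      have h1 : (restrAdj (H.comap f) Set.univ *ᵥ (y ∘ f)) i = (restrAdj H Set.univ *ᵥ y) (f i) := by
        calc (restrAdj (H.comap f) Set.univ *ᵥ (y ∘ f)) i
            = ∑ j, restrAdj H Set.univ (f i) (f j) * y (f j) :=
              Finset.sum_congr (s₁ := Finset.univ) rfl fun j _ =>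
                congrArg (· * y (f j)) (hent i j)
          _ = ∑ v ∈ F, restrAdj H Set.univ (f i) v * y v :=
              hsum (fun v => restrAdj H Set.univ (f i) v * y v)
          _ = ∑ v, restrAdj H Set.univ (f i) v * y v := by
              refine Finset.sum_subset (Finset.subset_univ _) fun v _ hv => ?_
              rw [hout _ _ (hfC i) hv, zero_mul]
          _ = _ := rfl
      rw [h1, hy]
      rfl
  · intro μ hμ
    rw [mem_spectrum_iff_exists_mulVec_eq] at hμ
    obtain ⟨x, hx0, hx⟩ := hμ
    let z : V → ℝ := fun v => if h : v ∈ F then x (F.equivFin ⟨v, h⟩) else 0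
    have hzf : ∀ i, z (f i) = x i := by
      intro i
      have : f i ∈ F := (e i).2
      simp only [z, dif_pos this]
      congr 1
      simp [f, e]
    have hz0 : ∀ v, v ∉ F → z v = 0 := fun v hv => dif_neg hv
    have h1 : z ⬝ᵥ restrAdj H Set.univ *ᵥ z ≤ c * (z ⬝ᵥ z) := by
      by_contra! hlt
      exact hC ⟨z, fun v hv => hz0 v (fun h => hv ((hmemF v).mp h)), hlt⟩
    have h2 : z ⬝ᵥ z = x ⬝ᵥ x := by
      calc z ⬝ᵥ z = ∑ v ∈ F, z v * z v := by
            symm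
            exact Finset.sum_subset (Finset.subset_univ _) fun v _ hv => by rw [hz0 v hv, zero_mul]
        _ = ∑ i, z (f i) * z (f i) := (hsum (fun v => z v * z v)).symm
        _ = _ := by simp only [hzf]; rfl
    have h3 : z ⬝ᵥ restrAdj H Set.univ *ᵥ z = x ⬝ᵥ restrAdj (H.comap f) Set.univ *ᵥ x := by
      have h4 : ∀ v, (restrAdj H Set.univ *ᵥ z) v =
          ∑ j, restrAdj H Set.univ v (f j) * x j := by
        intro v
        calc (restrAdj H Set.univ *ᵥ z) v = ∑ w ∈ F, restrAdj H Set.univ v w * z w := by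
              symm
              exact Finset.sum_subset (Finset.subset_univ _) fun w _ hw => by
                rw [hz0 w hw, mul_zero]
          _ = ∑ j, restrAdj H Set.univ v (f j) * z (f j) :=
              (hsum (fun w => restrAdj H Set.univ v w * z w)).symm
          _ = _ := by simp only [hzf]
      calc z ⬝ᵥ restrAdj H Set.univ *ᵥ z
          = ∑ v ∈ F, z v * (restrAdj H Set.univ *ᵥ z) v := by
            symm
            exact Finset.sum_subset (Finset.subset_univ _) fun v _ hv => by rw [hz0 v hv, zero_mul]
        _ = ∑ i, z (f i) * (restrAdj H Set.univ *ᵥ z) (f i) :=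
            (hsum (fun v => z v * (restrAdj H Set.univ *ᵥ z) v)).symm
        _ = _ := by
            refine Finset.sum_congr rfl fun i _ => ?_
            rw [hzf, h4]
            exact congrArg (x i * ·)
              (Finset.sum_congr rfl fun j _ => congrArg (· * x j) (hent i j).symm)
    rw [h2, h3, hx, dotProduct_smul, smul_eq_mul] at h1
    have hpos : 0 < x ⬝ᵥ x := by
      obtain ⟨i, hi⟩ := Function.ne_iff.mp hx0
      exact Finset.sum_pos' (fun _ _ => mul_self_nonneg _) ⟨i, Finset.mem_univ i,
        mul_self_pos.mpr hi⟩
    exact le_of_mul_le_mul_right h1 hpos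

/-- A nonzero eigenvalue forces an edge. This makes `ε = 1 / 2` always admissible and keeps `k - 1`
positive. -/
theorem two_le_of_isTopEigenvalue {k : ℕ} {G : SimpleGraph (Fin k)} {c : ℝ} (hc : 0 < c)
    (h : IsTopEigenvalue G c) : 2 ≤ k := by
  classical
  obtain ⟨x, hx0, hx⟩ :=
    (mem_spectrum_iff_exists_mulVec_eq _ _).mp ((isTopEigenvalue_iff G c).mp h).1
  obtain ⟨i, hi⟩ := Function.ne_iff.mp hx0
  have h1 : ∑ j, restrAdj G Set.univ i j * x j ≠ 0 := by
    have := congrFun hx i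
    rw [Pi.smul_apply, smul_eq_mul] at this
    intro h0
    exact mul_ne_zero hc.ne' hi (this.symm.trans h0)
  obtain ⟨j, -, hj⟩ := Finset.exists_ne_zero_of_sum_ne_zero h1
  have hij : G.Adj i j := by
    by_contra hn
    exact hj (by simp [restrAdj, hn])
  have := i.2
  have := j.2
  have : (i : ℕ) ≠ j := fun h => hij.ne (Fin.ext h)
  omega

/-! ### Separated sets and the multiplicity bound. -/

/-- `S` and `T` are disjoint, with no edges of `H` between them. -/
def IsSeparated {V : Type*} (H : SimpleGraph V) (S T : Set V) : Prop :=
  ∀ u ∈ S, ∀ w ∈ T, u ≠ w ∧ ¬ H.Adj u w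

/-- At most two pairwise separated sets carry vectors of Rayleigh quotient above `c`. -/
def AtMostTwoExceed {V : Type*} [Fintype V] (H : SimpleGraph V) (c : ℝ) : Prop :=
  ∀ S₁ S₂ S₃ : Set V, ExceedsOn H c S₁ → ExceedsOn H c S₂ → ExceedsOn H c S₃ →
    IsSeparated H S₁ S₂ → IsSeparated H S₁ S₃ → IsSeparated H S₂ S₃ → False

/-- The odd radius `2 * R + 1` also excludes an edge between the two balls. -/
theorem isSeparated_walkBall {V : Type*} {H : SimpleGraph V} {v w : V} {R : ℕ}
    (h : w ∉ walkBall H v (2 * R + 1)) : IsSeparated H (walkBall H v R) (walkBall H w R) := by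
  rintro u ⟨p, hp⟩ u' ⟨p', hp'⟩
  constructor
  · rintro rfl
    exact h ⟨p.append p'.reverse, by simp; omega⟩
  · intro hadj
    exact h ⟨(p.concat hadj).append p'.reverse, by simp; omega⟩

theorem isSeparated_supp {V : Type*} {H : SimpleGraph V} {C C' : H.ConnectedComponent}
    (h : C ≠ C') : IsSeparated H C.supp C'.supp := by
  intro u hu w hw
  rw [SimpleGraph.ConnectedComponent.mem_supp_iff] at hu hw
  constructor
  · rintro rfl
    exact h (hu.symm.trans hw)
  · intro hadj
    exact h (hu.symm.trans ((SimpleGraph.ConnectedComponent.connectedComponentMk_eq_of_adj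
      hadj).trans hw))

open scoped Classical in
theorem exists_finset_walkBall {V : Type*} [Fintype V] {H : SimpleGraph V} {D : ℕ}
    (hD : ∀ v, (Finset.univ.filter (H.Adj v)).card ≤ D) (r : ℕ) (v : V) :
    ∃ F : Finset V, F.card ≤ (D + 1) ^ r ∧ ∀ w ∈ walkBall H v r, w ∈ F := by
  induction r generalizing v with
  | zero =>
    refine ⟨{v}, by simp, ?_⟩
    rintro w ⟨p, hp⟩
    simp [SimpleGraph.Walk.eq_of_length_eq_zero (Nat.le_zero.mp hp)]
  | succ r ih =>
    choose F hF hF' using ih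
    refine ⟨insert v ((Finset.univ.filter (H.Adj v)).biUnion F), ?_, ?_⟩
    · refine (Finset.card_insert_le _ _).trans ?_
      have h1 := (Finset.card_biUnion_le_card_mul (Finset.univ.filter (H.Adj v)) F _
        (fun u _ => hF u)).trans (Nat.mul_le_mul_right _ (hD v))
      have h2 : 1 ≤ (D + 1) ^ r := Nat.one_le_pow _ _ (by omega)
      rw [pow_succ]
      linarith
    · rintro w ⟨p, hp⟩
      cases p with
      | nil => exact Finset.mem_insert_self _ _
      | cons h p =>
        refine Finset.mem_insert_of_mem (Finset.mem_biUnion.mpr ⟨_, by simpa using h, ?_⟩)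
        exact hF' _ w ⟨p, by simpa using hp⟩

-- If no two balls of radius `2 * R + 1` covered the exceeding centres, three centres would have
-- mutually separated exceeding balls.
open scoped Classical in
theorem card_exceedsOn_walkBall_le {V : Type*} [Fintype V] {H : SimpleGraph V} {D : ℕ}
    (hD : ∀ v, (Finset.univ.filter (H.Adj v)).card ≤ D) {c : ℝ} (h2 : AtMostTwoExceed H c)
    (R : ℕ) :
    (Finset.univ.filter (fun v => ExceedsOn H c (walkBall H v R))).card ≤
      2 * (D + 1) ^ (2 * R + 1) := by
  set U := Finset.univ.filter (fun v => ExceedsOn H c (walkBall H v R)) with hU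
  have hmem : ∀ v, v ∈ U → ExceedsOn H c (walkBall H v R) := fun v hv => by simpa [hU] using hv
  rcases U.eq_empty_or_nonempty with h0 | ⟨a, ha⟩
  · simp [h0]
  have hcov : ∃ b : V, ∀ w ∈ U, w ∈ walkBall H a (2 * R + 1) ∨ w ∈ walkBall H b (2 * R + 1) := by
    by_contra! hcon
    obtain ⟨b, hb, hab, -⟩ := hcon a
    obtain ⟨d, hd, had, hbd⟩ := hcon b
    exact h2 _ _ _ (hmem a ha) (hmem b hb) (hmem d hd) (isSeparated_walkBall hab)
      (isSeparated_walkBall had) (isSeparated_walkBall hbd)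
  obtain ⟨b, hb⟩ := hcov
  obtain ⟨Fa, hFa, hFa'⟩ := exists_finset_walkBall hD (2 * R + 1) a
  obtain ⟨Fb, hFb, hFb'⟩ := exists_finset_walkBall hD (2 * R + 1) b
  have hsub : U ⊆ Fa ∪ Fb := by
    intro w hw
    rcases hb w hw with h | h
    · exact Finset.mem_union_left _ (hFa' w h)
    · exact Finset.mem_union_right _ (hFb' w h)
  have := (Finset.card_le_card hsub).trans (Finset.card_union_le _ _)
  omega

theorem exists_adj_dist_eq {V : Type*} {H : SimpleGraph V} {a u : V} (h : H.Reachable a u) {n : ℕ}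
    (hn : H.dist a u = n + 1) : ∃ w, H.Adj u w ∧ H.dist a w = n := by
  obtain ⟨p, hp⟩ := h.symm.exists_walk_length_eq_dist
  rw [SimpleGraph.dist_comm, hn] at hp
  cases p with
  | nil => simp at hp
  | cons hadj p =>
    rename_i w
    refine ⟨w, hadj, le_antisymm ?_ ?_⟩
    · have := SimpleGraph.dist_le p.reverse
      simp at this hp
      omega
    · obtain ⟨p', hp'⟩ := (p.reverse.reachable).exists_walk_length_eq_dist
      have := SimpleGraph.dist_le (p'.concat hadj.symm)
      simp at this
      omega

/-- The vertices at distance `≡ j` modulo `t + 1` from a root, with the root itself, are within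
distance `t` of every vertex. -/
theorem isNear_of_residue_subset {V : Type*} {H : SimpleGraph V} {a : V} {Z : Set V} {t j : ℕ}
    (hj : j < t + 1) (ha : a ∈ Z)
    (hZ : ∀ u, H.Reachable a u → H.dist a u % (t + 1) = j → u ∈ Z) {u : V}
    (hu : H.Reachable a u) : IsNear H Z t u := by
  have key : ∀ i u, H.Reachable a u → H.dist a u % (t + 1) = (j + i) % (t + 1) →
      IsNear H Z i u := by
    intro i
    induction i with
    | zero =>
      intro u hu h
      exact hZ u hu (by rwa [add_zero, Nat.mod_eq_of_lt hj] at h)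
    | succ i ih =>
      intro u hu h
      rcases hd : H.dist a u with _ | n
      · left
        rwa [← hu.dist_eq_zero_iff.mp hd]
      · obtain ⟨w, hw, hdw⟩ := exists_adj_dist_eq hu hd
        refine Or.inr ⟨w, hw, ih w (hu.trans hw.reachable) ?_⟩
        rw [hd, ← add_assoc] at h
        rw [hdw]
        exact Nat.ModEq.add_right_cancel' 1 h
  -- Walking towards the root meets residue `j` within `t` steps, unless the root comes first; hence
  -- the root must lie in `Z`.
  by_cases h : j ≤ H.dist a u % (t + 1)
  · have hlt : H.dist a u % (t + 1) < t + 1 := Nat.mod_lt _ (Nat.succ_pos t)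
    refine (key (H.dist a u % (t + 1) - j) u hu ?_).mono (by omega)
    rw [Nat.add_sub_cancel' h, Nat.mod_mod]
  · refine (key (H.dist a u % (t + 1) + (t + 1) - j) u hu ?_).mono (by omega)
    rw [Nat.add_sub_cancel' (by omega), Nat.add_mod_right, Nat.mod_mod]

open scoped Classical in
/-- In bounded degree, if at most two separated sets exceed `c` and every graph with largest
eigenvalue `c` has at least `1 / ε` vertices, then the multiplicity of `c` is at most
`ε * |V| + O(1)`. -/
theorem exists_finrank_le {c ε : ℝ} (hc : 0 < c) (hε : 0 < ε) (D : ℕ)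
    (hk : ∀ k : ℕ, (∃ G : SimpleGraph (Fin k), IsTopEigenvalue G c) → 1 ≤ ε * k) :
    ∃ C : ℝ, ∀ (V : Type) [Fintype V] (H : SimpleGraph V),
      (∀ v, (Finset.univ.filter (H.Adj v)).card ≤ D) → AtMostTwoExceed H c →
      ∀ K : Submodule ℝ (V → ℝ), (∀ y ∈ K, restrAdj H Set.univ *ᵥ y = c • y) →
        (Module.finrank ℝ K : ℝ) ≤ ε * Fintype.card V + C := by
  obtain ⟨t, ht⟩ : ∃ t : ℕ, 2 / ε ≤ t := exists_nat_ge _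
  have hct : 0 < c ^ (2 * t) := pow_pos hc _
  set θ : ℝ := max (c ^ (2 * t) - 1) 0 with hθ
  have hθ0 : 0 ≤ θ := le_max_right _ _
  have hθ1 : θ / c ^ (2 * t) < 1 := by
    rw [div_lt_one hct]
    exact max_lt (by linarith) hct
  obtain ⟨s, hs⟩ := exists_pow_lt_of_lt_one (half_pos hε) hθ1
  refine ⟨2 + (2 * (D + 1) ^ (2 * (t * s + t) + 1) : ℕ), ?_⟩
  intro V _ H hD h2 K hK
  let cc : V → H.ConnectedComponent := H.connectedComponentMk
  let root : H.ConnectedComponent → V := Quot.out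
  have hroot : ∀ C, cc (root C) = C := fun C => Quot.out_eq C
  have hreach : ∀ u, H.Reachable (root (cc u)) u := fun u =>
    SimpleGraph.ConnectedComponent.exact (hroot (cc u))
  let bad : H.ConnectedComponent → Prop := fun C => ExceedsOn H c C.supp
  let comps := Finset.univ.image cc
  have hcomps : ∀ u, cc u ∈ comps := fun u => Finset.mem_image_of_mem _ (Finset.mem_univ u)
  let X := Finset.univ.filter (fun v => bad (cc v))
  let E := comps.filter (fun C => ¬ bad C ∧ ∃ y ∈ K, ∃ u ∈ C.supp, y u ≠ 0)
  let U := Finset.univ.filter (fun v => ExceedsOn H c (walkBall H v (t * s + t)))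
  let lev : V → ℕ := fun u => H.dist (root (cc u)) u % (t + 1)
  have htpos : (0 : ℝ) < t + 1 := by positivity
  -- Pigeonhole over the residues of the distance to the root.
  obtain ⟨j, hj, hjX⟩ : ∃ j ∈ Finset.range (t + 1),
      ((X.filter (fun u => lev u = j)).card : ℝ) ≤ X.card / (t + 1) := by
    refine Finset.exists_card_fiber_le_of_card_le_nsmul (by simp) ?_
    rw [Finset.card_range, nsmul_eq_mul]
    push_cast
    rw [mul_div_cancel₀ _ htpos.ne']
  rw [Finset.mem_range] at hj
  let badc := comps.filter bad
  -- Centres of exceeding balls, roots of exceeding components, the net, and one root for every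
  -- other component that carries an eigenvector.
  let Z := (U ∪ badc.image root) ∪ (X.filter (fun u => lev u = j) ∪ E.image root)
  have hbadc : badc.card ≤ 2 := by
    by_contra! hlt
    obtain ⟨a, ha, b, hb, d, hd, hab, had, hbd⟩ := Finset.two_lt_card.mp hlt
    exact h2 _ _ _ (Finset.mem_filter.mp ha).2 (Finset.mem_filter.mp hb).2
      (Finset.mem_filter.mp hd).2 (isSeparated_supp hab) (isSeparated_supp had)
      (isSeparated_supp hbd)
  have hE : (E.card : ℝ) ≤ ε * (Fintype.card V - X.card) := by
    have h1 : ∀ C ∈ E, (1 : ℝ) ≤ ε * (Finset.univ.filter (fun v => cc v = C)).card := by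
      intro C hC
      obtain ⟨-, hg, y, hy, u, hu, hyu⟩ := Finset.mem_filter.mp hC
      exact hk _ (exists_isTopEigenvalue_of_component hg (hK y hy) hu hyu)
    have h3 : ∑ C ∈ E, (Finset.univ.filter (fun v => cc v = C)).card =
        (Finset.univ.filter (fun v => cc v ∈ E)).card := by
      rw [Finset.card_eq_sum_card_fiberwise (f := cc) (t := E) (by
        intro v hv
        simpa using hv)]
      refine Finset.sum_congr rfl fun C hC => ?_
      congr 1
      ext v
      simp only [Finset.mem_filter, Finset.mem_univ, true_and]
      exact ⟨fun h => ⟨h ▸ hC, h⟩, fun h => h.2⟩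
    have h4 : (Finset.univ.filter (fun v => cc v ∈ E)).card + X.card ≤ Fintype.card V := by
      rw [← Finset.card_union_of_disjoint]
      · exact Finset.card_le_univ _
      · rw [Finset.disjoint_filter]
        intro v _ hv hb
        exact (Finset.mem_filter.mp hv).2.1 hb
    calc (E.card : ℝ) = ∑ C ∈ E, (1 : ℝ) := by simp
      _ ≤ ∑ C ∈ E, ε * (Finset.univ.filter (fun v => cc v = C)).card := Finset.sum_le_sum h1
      _ = ε * (Finset.univ.filter (fun v => cc v ∈ E)).card := by
          rw [← Finset.mul_sum, ← h3]
          push_cast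
          rfl
      _ ≤ ε * (Fintype.card V - X.card) := by
          refine mul_le_mul_of_nonneg_left ?_ hε.le
          have : ((Finset.univ.filter (fun v => cc v ∈ E)).card : ℝ) + X.card ≤
            Fintype.card V := by exact_mod_cast h4
          linarith
  let W : Submodule ℝ (V → ℝ) :=
    { carrier := {y | y ∈ K ∧ ∀ z ∈ Z, y z = 0}
      add_mem' := fun {a b} ha hb => ⟨K.add_mem ha.1 hb.1, fun z hz => by
        rw [Pi.add_apply, ha.2 z hz, hb.2 z hz, add_zero]⟩
      zero_mem' := ⟨K.zero_mem, fun _ _ => rfl⟩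
      smul_mem' := fun r a ha => ⟨K.smul_mem r ha.1, fun z hz => by
        rw [Pi.smul_apply, ha.2 z hz, smul_zero]⟩ }
  have hKW := card_le_add_finrank K Z W fun y hy hz => ⟨hy, hz⟩
  have hZcard : (Z.card : ℝ) ≤ (2 * (D + 1) ^ (2 * (t * s + t) + 1) : ℕ) + 2 +
      X.card / (t + 1) + ε * (Fintype.card V - X.card) := by
    have h1 : Z.card ≤ (U.card + badc.card) +
        ((X.filter (fun u => lev u = j)).card + E.card) :=
      (Finset.card_union_le _ _).trans (Nat.add_le_add
        ((Finset.card_union_le _ _).trans (Nat.add_le_add_left Finset.card_image_le _))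
        ((Finset.card_union_le _ _).trans (Nat.add_le_add_left Finset.card_image_le _)))
    have h3 : U.card ≤ _ := card_exceedsOn_walkBall_le hD h2 (t * s + t)
    have h1' : (Z.card : ℝ) ≤ (U.card + badc.card) +
        ((X.filter (fun u => lev u = j)).card + E.card) := by exact_mod_cast h1
    have h3' : (U.card : ℝ) ≤ (2 * (D + 1) ^ (2 * (t * s + t) + 1) : ℕ) := by exact_mod_cast h3
    have h4' : (badc.card : ℝ) ≤ 2 := by exact_mod_cast hbadc
    linarith
  have hXmem : ∀ v, v ∈ (X : Set V) ↔ bad (cc v) := fun v => by simp [X]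
  have hWdim : (Module.finrank ℝ W : ℝ) * c ^ (2 * (t * s)) ≤ X.card * θ ^ s := by
    refine finrank_mul_pow_le hc W (Z : Set V) (X : Set V) X (fun v hv _ => hv)
      (fun y hy => hK y hy.1) (fun y hy v hv => hy.2 v hv) ?_ ?_ hθ0 (le_max_left _ _)
    -- Outside `X`, vanishing at the root of a component forces vanishing on all of it.
    · intro y hy v hv
      by_contra hyv
      rw [hXmem] at hv
      have hEv : cc v ∈ E := Finset.mem_filter.mpr ⟨hcomps v, hv, y, hy.1, v, rfl, hyv⟩
      have hr : root (cc v) ∈ Z :=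
        Finset.mem_union_right _ (Finset.mem_union_right _ (Finset.mem_image_of_mem _ hEv))
      exact hyv (eq_zero_on_component hc hv (hK y hy.1) (u := root (cc v))
        (hroot (cc v)) (hy.2 _ hr) rfl)
    · intro v hv hvZ
      rw [hXmem] at hv
      refine ⟨fun hex => hvZ ?_, ?_⟩
      · exact Finset.mem_union_left _ (Finset.mem_union_left _ (by simpa [U] using hex))
      · rintro u ⟨p, -⟩
        have hcu : cc u = cc v := SimpleGraph.ConnectedComponent.sound p.reachable.symm
        have hru : ∀ w, H.Reachable (root (cc v)) w → cc w = cc v := fun w hw =>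
          (SimpleGraph.ConnectedComponent.sound hw.symm).trans (hroot (cc v))
        refine isNear_of_residue_subset (a := root (cc v)) hj ?_ ?_ (hcu ▸ hreach u)
        · exact Finset.mem_union_left _ (Finset.mem_union_right _
            (Finset.mem_image_of_mem _ (Finset.mem_filter.mpr ⟨hcomps v, hv⟩)))
        · intro w hw hdw
          refine Finset.mem_union_right _ (Finset.mem_union_left _
            (Finset.mem_filter.mpr ⟨?_, ?_⟩))
          · exact (hXmem w).mpr ((hru w hw).symm ▸ hv)
          · simp only [lev, hru w hw]
            exact hdw
  have hW2 : (Module.finrank ℝ W : ℝ) ≤ X.card * (ε / 2) := by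
    have hpos : 0 < c ^ (2 * (t * s)) := pow_pos hc _
    have h1 : (Module.finrank ℝ W : ℝ) ≤ X.card * (θ / c ^ (2 * t)) ^ s := by
      rw [div_pow, ← pow_mul, mul_assoc 2 t s, mul_div_assoc', le_div_iff₀ hpos]
      exact hWdim
    exact h1.trans (mul_le_mul_of_nonneg_left hs.le (Nat.cast_nonneg _))
  have hXt : (X.card : ℝ) / (t + 1) ≤ X.card * (ε / 2) := by
    rw [div_le_iff₀ htpos, mul_assoc]
    refine le_mul_of_one_le_right (Nat.cast_nonneg _) ?_
    have : 2 ≤ t * ε := (div_le_iff₀ hε).mp ht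
    nlinarith
  have hKW' : (Module.finrank ℝ K : ℝ) ≤ Z.card + Module.finrank ℝ W := by exact_mod_cast hKW
  -- The net and `W` cost `ε / 2` each per vertex of `X`, the roots in `E` cost `ε` per vertex
  -- outside `X`, and the rest is bounded.
  linarith

/-! ### From Gram matrices to eigenspaces. -/

theorem IsSeparated.dotProduct_eq_zero {V : Type*} [Fintype V] {H : SimpleGraph V} {S T : Set V}
    (h : IsSeparated H S T) {y z : V → ℝ} (hy : ∀ v, v ∉ S → y v = 0) (hz : ∀ v, v ∉ T → z v = 0) :
    y ⬝ᵥ z = 0 ∧ y ⬝ᵥ restrAdj H Set.univ *ᵥ z = 0 := by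
  constructor
  · refine Finset.sum_eq_zero fun v _ => ?_
    by_cases hS : v ∈ S
    · rw [hz v fun hT => (h v hS v hT).1 rfl, mul_zero]
    · rw [hy v hS, zero_mul]
  · refine Finset.sum_eq_zero fun v _ => ?_
    by_cases hS : v ∈ S
    · have : (restrAdj H Set.univ *ᵥ z) v = 0 := by
        refine Finset.sum_eq_zero fun w _ => ?_
        change restrAdj H Set.univ v w * z w = 0
        by_cases hT : w ∈ T
        · have := (h v hS w hT).2
          simp [restrAdj, this]
        · rw [hz w hT, mul_zero]
      rw [this, mul_zero]
    · rw [hy v hS, zero_mul]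

/-- If the quadratic form of `c - A` is nonnegative on a subspace of codimension two, then at most
two separated sets exceed `c`. -/
theorem atMostTwoExceed_of_nonneg_on_ker {V : Type*} [Fintype V] {H : SimpleGraph V} {c : ℝ}
    (φ : (V → ℝ) →ₗ[ℝ] ℝ × ℝ)
    (h : ∀ y, φ y = 0 → y ⬝ᵥ restrAdj H Set.univ *ᵥ y ≤ c * (y ⬝ᵥ y)) : AtMostTwoExceed H c := by
  rintro S₁ S₂ S₃ ⟨y₁, hs₁, hy₁⟩ ⟨y₂, hs₂, hy₂⟩ ⟨y₃, hs₃, hy₃⟩ h12 h13 h23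
  set A := restrAdj H Set.univ with hA
  have hsym : A.IsSymm := restrAdj_isSymm _ _
  obtain ⟨d12, a12⟩ := h12.dotProduct_eq_zero hs₁ hs₂
  obtain ⟨d13, a13⟩ := h13.dotProduct_eq_zero hs₁ hs₃
  obtain ⟨d23, a23⟩ := h23.dotProduct_eq_zero hs₂ hs₃
  rw [← hA] at a12 a13 a23
  have d21 : y₂ ⬝ᵥ y₁ = 0 := by rw [dotProduct_comm, d12]
  have d31 : y₃ ⬝ᵥ y₁ = 0 := by rw [dotProduct_comm, d13]
  have d32 : y₃ ⬝ᵥ y₂ = 0 := by rw [dotProduct_comm, d23]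
  have a21 : y₂ ⬝ᵥ A *ᵥ y₁ = 0 := by
    rw [dotProduct_mulVec_comm_of_isSymm hsym, dotProduct_comm, a12]
  have a31 : y₃ ⬝ᵥ A *ᵥ y₁ = 0 := by
    rw [dotProduct_mulVec_comm_of_isSymm hsym, dotProduct_comm, a13]
  have a32 : y₃ ⬝ᵥ A *ᵥ y₂ = 0 := by
    rw [dotProduct_mulVec_comm_of_isSymm hsym, dotProduct_comm, a23]
  let f : (Fin 3 → ℝ) →ₗ[ℝ] ℝ × ℝ := φ.comp (Fintype.linearCombination ℝ ![y₁, y₂, y₃])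
  have hker : LinearMap.ker f ≠ ⊥ := LinearMap.ker_ne_bot_of_finrank_lt (by simp)
  obtain ⟨w, hw, hw0⟩ := Submodule.exists_mem_ne_zero_of_ne_bot hker
  have hz : φ (w 0 • y₁ + w 1 • y₂ + w 2 • y₃) = 0 := by
    have : f w = 0 := hw
    simpa [f, Fintype.linearCombination_apply, Fin.sum_univ_three] using this
  have hq := h _ hz
  simp only [mulVec_add, mulVec_smul, add_dotProduct, dotProduct_add, smul_dotProduct,
    dotProduct_smul, smul_eq_mul, d12, d13, d23, d21, d31, d32, a12, a13, a23, a21, a31, a32] at hq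
  have hlt : ∀ {r s x : ℝ}, r < s → x ^ 2 * (s - r) ≤ 0 → x = 0 := by
    intro r s x hrs hx
    by_contra hx0
    have : 0 < x ^ 2 := by positivity
    nlinarith
  have n1 := mul_nonneg (sq_nonneg (w 0)) (sub_pos.mpr hy₁).le
  have n2 := mul_nonneg (sq_nonneg (w 1)) (sub_pos.mpr hy₂).le
  have n3 := mul_nonneg (sq_nonneg (w 2)) (sub_pos.mpr hy₃).le
  have e0 : w 0 = 0 := hlt hy₁ (by linarith)
  have e1 : w 1 = 0 := hlt hy₂ (by linarith)
  have e2 : w 2 = 0 := hlt hy₃ (by linarith)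
  apply hw0
  ext i
  fin_cases i
  · exact e0
  · exact e1
  · exact e2

open scoped Classical in
/-- The size of a code whose negative-inner-product graph is close to complete bipartite. -/
theorem exists_card_le_of_two_parts {α β c ε : ℝ} (hαβ : β < α) (hα : α < 1)
    (hc : c = (1 - α) / (α - β)) (hε : 0 < ε) (D : ℕ)
    (hk : ∀ k : ℕ, (∃ G : SimpleGraph (Fin k), IsTopEigenvalue G c) → 1 ≤ ε * k) :
    ∃ C : ℝ, ∀ (d : ℕ) (V : Type) [Fintype V] (x : V → EuclideanSpace ℝ (Fin d)) (σ : V → Bool),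
      (∀ u, ‖x u‖ = 1) → (∀ u w, u ≠ w → inner ℝ (x u) (x w) = α ∨ inner ℝ (x u) (x w) = β) →
      (∀ v, (Finset.univ.filter (fun w => v ≠ w ∧
        inner ℝ (x v) (x w) = if σ v = σ w then β else α)).card ≤ D) →
      (1 - ε) * Fintype.card V ≤ d + C := by
  have hγ : 0 < α - β := by linarith
  have hcγ : (α - β) * c = 1 - α := by rw [hc]; field_simp
  have hc0 : 0 < c := by rw [hc]; exact div_pos (by linarith) hγ
  obtain ⟨C, hC⟩ := exists_finrank_le hc0 hε D hk
  refine ⟨C + 2, ?_⟩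
  intro d V _ x σ hx hin hdeg
  let H : SimpleGraph V :=
    { Adj := fun v w => v ≠ w ∧ inner ℝ (x v) (x w) = if σ v = σ w then β else α
      symm := ⟨fun v w h => ⟨h.1.symm, by rw [real_inner_comm, h.2]; simp only [eq_comm]⟩⟩
      loopless := ⟨fun v h => h.1 rfl⟩ }
  set A := restrAdj H Set.univ with hA
  -- After the sign change, the Gram entries without error are `α` within a part and `-β` across;
  -- `g` is this block-constant matrix. It vanishes on vectors whose two part sums, recorded by `φ`,
  -- are zero.
  let sg : V → ℝ := fun v => if σ v then 1 else -1
  let g : V → V → ℝ := fun u w => if σ u = σ w then α else -β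
  have hgram : ∀ w u, sg u * sg w * inner ℝ (x u) (x w) =
      g u w + (if w = u then 1 - α else 0) - (α - β) * A w u := by
    intro w u
    have hAuw : A w u = if (w ≠ u ∧ inner ℝ (x u) (x w) = if σ u = σ w then β else α)
        then 1 else 0 := by
      simp only [hA, restrAdj, of_apply, Set.mem_univ, and_true, H]
      rw [real_inner_comm]
      simp only [eq_comm (a := σ w) (b := σ u)]
    by_cases huw : w = u
    · subst huw
      have : sg w * sg w = 1 := by
        by_cases h : σ w <;> simp [sg, h]
      rw [hAuw, real_inner_self_eq_norm_sq, hx, this]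
      simp [g]
    · have hne : ¬ u = w := fun h => huw h.symm
      rw [hAuw]
      simp only [huw, ne_eq, not_false_eq_true, true_and, if_false, g, sg]
      rcases hin u w hne with h | h <;> rw [h] <;> cases hu : σ u <;> cases hw : σ w <;>
        simp [hαβ.ne, hαβ.ne'] <;> ring
  let Φ : (V → ℝ) →ₗ[ℝ] EuclideanSpace ℝ (Fin d) :=
    Fintype.linearCombination ℝ (fun u => sg u • x u)
  have hΦ : ∀ y, Φ y = ∑ u, y u • (sg u • x u) := fun y => Fintype.linearCombination_apply ..
  let P : Bool → (V → ℝ) →ₗ[ℝ] ℝ := fun b => Fintype.linearCombination ℝ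
    (fun u => if σ u = b then (1 : ℝ) else 0)
  have hP : ∀ b y, P b y = ∑ u, y u * (if σ u = b then (1 : ℝ) else 0) := fun b y =>
    Fintype.linearCombination_apply ..
  let φ : (V → ℝ) →ₗ[ℝ] ℝ × ℝ := (P true).prod (P false)
  have hbil : ∀ y, φ y = 0 → ∀ w, inner ℝ (Φ y) (sg w • x w) =
      (α - β) * (c * y w - (A *ᵥ y) w) := by
    intro y hy w
    have hPy : ∀ b, P b y = 0 := by
      have h1 : P true y = 0 := congrArg Prod.fst hy
      have h2 : P false y = 0 := congrArg Prod.snd hy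
      rintro (_ | _)
      · exact h2
      · exact h1
    have hg : ∑ u, y u * g u w = 0 := by
      have : ∀ u, y u * g u w = α * (y u * (if σ u = σ w then (1 : ℝ) else 0)) +
          (-β) * (y u * (if σ u = !σ w then (1 : ℝ) else 0)) := by
        intro u
        cases hu : σ u <;> cases hw : σ w <;> simp [g, hu, hw] <;> ring
      simp only [this, Finset.sum_add_distrib, ← Finset.mul_sum]
      rw [← hP, ← hP, hPy, hPy]
      ring
    have hAy : (A *ᵥ y) w = ∑ u, A w u * y u := rfl
    calc inner ℝ (Φ y) (sg w • x w)
        = ∑ u, y u * (sg u * sg w * inner ℝ (x u) (x w)) := by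
          rw [hΦ, sum_inner]
          refine Finset.sum_congr rfl fun u _ => ?_
          simp only [real_inner_smul_left, real_inner_smul_right]
          ring
      _ = ∑ u, (y u * g u w + (if w = u then (1 - α) * y u else 0) -
            (α - β) * (A w u * y u)) := by
          refine Finset.sum_congr rfl fun u _ => ?_
          rw [hgram]
          split_ifs <;> ring
      _ = (α - β) * (c * y w - (A *ᵥ y) w) := by
          rw [Finset.sum_sub_distrib, Finset.sum_add_distrib, hg, ← Finset.mul_sum, ← hAy,
            Finset.sum_ite_eq, if_pos (Finset.mem_univ w), ← hcγ]
          ring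
  have hquad : ∀ y, φ y = 0 → y ⬝ᵥ A *ᵥ y ≤ c * (y ⬝ᵥ y) := by
    intro y hy
    have h1 : inner ℝ (Φ y) (Φ y) = (α - β) * (c * (y ⬝ᵥ y) - y ⬝ᵥ A *ᵥ y) := by
      conv_lhs => rw [hΦ y, inner_sum, ← hΦ y]
      simp only [real_inner_smul_right _ (sg _ • _), hbil y hy, dotProduct]
      rw [Finset.mul_sum, ← Finset.sum_sub_distrib, Finset.mul_sum]
      exact Finset.sum_congr rfl fun u _ => by ring
    have h2 : 0 ≤ inner ℝ (Φ y) (Φ y) := real_inner_self_nonneg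
    rw [h1] at h2
    have := nonneg_of_mul_nonneg_right h2 hγ
    linarith
  -- On the kernel of `Ψ` the Gram identity reads `A *ᵥ y = c • y`, while the range has dimension at
  -- most `d + 2`.
  let Ψ : (V → ℝ) →ₗ[ℝ] EuclideanSpace ℝ (Fin d) × ℝ × ℝ := Φ.prod φ
  have hfin := hC V H (fun v => by convert hdeg v) (atMostTwoExceed_of_nonneg_on_ker φ hquad) (LinearMap.ker Ψ) (by
    intro y hy
    have hy1 : Φ y = 0 := congrArg Prod.fst (LinearMap.mem_ker.mp hy)
    have hy2 : φ y = 0 := congrArg Prod.snd (LinearMap.mem_ker.mp hy)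
    ext w
    have h1 := hbil y hy2 w
    rw [hy1, inner_zero_left] at h1
    have h2 := (mul_eq_zero.mp h1.symm).resolve_left hγ.ne'
    rw [Pi.smul_apply, smul_eq_mul]
    linarith)
  have hrank := Ψ.finrank_range_add_finrank_ker
  have hrange : Module.finrank ℝ (LinearMap.range Ψ) ≤ d + 2 := by
    refine (Submodule.finrank_le _).trans ?_
    simp
  rw [Module.finrank_fintype_fun_eq_card] at hrank
  have h3 : (Fintype.card V : ℝ) ≤ d + 2 + Module.finrank ℝ (LinearMap.ker Ψ) := by
    have : Fintype.card V ≤ d + 2 + Module.finrank ℝ (LinearMap.ker Ψ) := by omega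
    exact_mod_cast this
  linarith

/-! ### Patterns excluded by positivity of the inner product. -/

theorem inner_sum_sum_of_const {V E : Type*} [NormedAddCommGroup E] [InnerProductSpace ℝ E]
    {x : V → E} {A B : Finset V} {a : ℝ} (h : ∀ u ∈ A, ∀ w ∈ B, inner ℝ (x u) (x w) = a) :
    inner ℝ (∑ u ∈ A, x u) (∑ w ∈ B, x w) = A.card * (B.card * a) := by
  rw [sum_inner]
  simp only [inner_sum]
  rw [Finset.sum_congr rfl fun u hu => Finset.sum_congr rfl fun w hw => h u hu w hw]
  simp

theorem inner_sum_self_of_const {V E : Type*} [NormedAddCommGroup E] [InnerProductSpace ℝ E]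
    {x : V → E} (hx : ∀ u, ‖x u‖ = 1) {A : Finset V} {a : ℝ}
    (h : ∀ u ∈ A, ∀ w ∈ A, u ≠ w → inner ℝ (x u) (x w) = a) :
    inner ℝ (∑ u ∈ A, x u) (∑ w ∈ A, x w) = A.card * ((1 - a) + A.card * a) := by
  classical
  rw [sum_inner]
  simp only [inner_sum]
  have : ∀ u ∈ A, ∑ w ∈ A, inner ℝ (x u) (x w) = (1 - a) + A.card * a := by
    intro u hu
    have h1 : ∀ w ∈ A, inner ℝ (x u) (x w) = (if u = w then 1 - a else 0) + a := by
      intro w hw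
      by_cases huw : u = w
      · subst huw
        rw [real_inner_self_eq_norm_sq, hx]
        simp
      · rw [h u hu w hw huw]
        simp [huw]
    rw [Finset.sum_congr rfl h1, Finset.sum_add_distrib, Finset.sum_ite_eq, if_pos hu]
    simp
  rw [Finset.sum_congr rfl this, Finset.sum_const, nsmul_eq_mul]

section Code

variable {α β : ℝ} {V E : Type*} [NormedAddCommGroup E] [InnerProductSpace ℝ E] {x : V → E}
  {G : SimpleGraph V}

/-- The squared norm of the sum over a `K`-clique is `K * ((1 - β) + K * β)`. -/
theorem noClique_of_code (hx : ∀ u, ‖x u‖ = 1) (hadj : ∀ u w, G.Adj u w → inner ℝ (x u) (x w) = β)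
    {K : ℕ} (hK0 : 1 ≤ K) (hK : (1 - β) + K * β < 0) : NoClique G K := by
  rintro T hT rfl
  have h := inner_sum_self_of_const hx (fun u hu w hw huw => hadj u w (hT u hu w hw huw))
  have h0 : 0 ≤ inner ℝ (∑ u ∈ T, x u) (∑ u ∈ T, x u) := real_inner_self_nonneg
  rw [h] at h0
  have hpos : (0 : ℝ) < T.card := by exact_mod_cast hK0
  exact absurd (mul_neg_of_pos_of_neg hpos hK) (not_lt.mpr h0)

/-- Cauchy–Schwarz for `x v` against the difference of the two sums gives `L ^ 2 * (α - β) ^ 2 ≤ 2 *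
L * (1 - α)`. -/
theorem noSplit_of_code (hx : ∀ u, ‖x u‖ = 1)
    (hadj : ∀ u w, G.Adj u w → inner ℝ (x u) (x w) = β)
    (hnadj : ∀ u w, u ≠ w → ¬ G.Adj u w → inner ℝ (x u) (x w) = α)
    {L : ℕ} (hL0 : 1 ≤ L) (hL : 2 * (1 - α) < L * (α - β) ^ 2) : NoSplit G L := by
  intro v A₀ B₀ hA₀ hB₀ hAA hBB hAB hvA hvB
  obtain ⟨A, hAs, hA⟩ := Finset.exists_subset_card_eq hA₀
  obtain ⟨B, hBs, hB⟩ := Finset.exists_subset_card_eq hB₀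
  have hLpos : (0 : ℝ) < L := by exact_mod_cast hL0
  obtain ⟨a, ha⟩ : A.Nonempty := Finset.card_pos.mp (by omega)
  -- `NoSplit` does not require `v ∉ B`; it follows because `v` has a neighbour in `A` and no edges
  -- join `A` to `B`.
  have hvnB : ∀ w ∈ B, v ≠ w := by
    rintro w hw rfl
    exact hAB a (hAs ha) v (hBs hw) (hvA a (hAs ha)).symm
  have e1 := inner_sum_self_of_const hx (A := A) (a := α)
    (fun u hu w hw huw => hnadj u w huw (hAA u (hAs hu) w (hAs hw)))
  have e2 := inner_sum_self_of_const hx (A := B) (a := α)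
    (fun u hu w hw huw => hnadj u w huw (hBB u (hBs hu) w (hBs hw)))
  have e3 := inner_sum_sum_of_const (x := x) (A := A) (B := B) (a := α) (by
    intro u hu w hw
    refine hnadj u w ?_ (hAB u (hAs hu) w (hBs hw))
    rintro rfl
    exact hvB u (hBs hw) (hvA u (hAs hu)))
  have e4 := inner_sum_sum_of_const (x := x) (A := {v}) (B := A) (a := β) (by
    intro u hu w hw
    rw [Finset.mem_singleton.mp hu]
    exact hadj v w (hvA w (hAs hw)))
  have e5 := inner_sum_sum_of_const (x := x) (A := {v}) (B := B) (a := α) (by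
    intro u hu w hw
    rw [Finset.mem_singleton.mp hu]
    exact hnadj v w (hvnB w hw) (hvB w (hBs hw)))
  rw [hA] at e1 e3 e4
  rw [hB] at e2 e3 e5
  simp only [Finset.sum_singleton, Finset.card_singleton, Nat.cast_one, one_mul] at e4 e5
  set a := ∑ u ∈ A, x u
  set b := ∑ u ∈ B, x u
  have hcs := real_inner_mul_inner_self_le (x v) (a - b)
  have e6 : inner ℝ (a - b) (a - b) = 2 * L * (1 - α) := by
    rw [inner_sub_left, inner_sub_right, inner_sub_right, real_inner_comm a b, e1, e2, e3]
    ring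
  have e7 : inner ℝ (x v) (a - b) = L * (β - α) := by
    rw [inner_sub_right, e4, e5]
    ring
  rw [e6, e7, real_inner_self_eq_norm_sq, hx] at hcs
  nlinarith

/-- The sum of all vectors in the parts would have squared norm `(p + 1) * L * ((1 - α) + L * (α + p
* β))`. -/
theorem not_isMultipartite_of_code (hx : ∀ u, ‖x u‖ = 1)
    (hadj : ∀ u w, G.Adj u w → inner ℝ (x u) (x w) = β)
    (hnadj : ∀ u w, u ≠ w → ¬ G.Adj u w → inner ℝ (x u) (x w) = α)
    {L p : ℕ} (hL0 : 1 ≤ L) (hL : (1 - α) + L * (α + p * β) < 0) :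
    ¬ ∃ I, IsMultipartite G (p + 1) L I := by
  rintro ⟨I₀, hc, hi, hm⟩
  choose I hIs hI using fun i => Finset.exists_subset_card_eq (hc i)
  have hLpos : (0 : ℝ) < L := by exact_mod_cast hL0
  have e1 : ∀ i j, inner ℝ (∑ u ∈ I i, x u) (∑ u ∈ I j, x u) =
      (if i = j then L * ((1 - α) + L * α) - L * (L * β) else 0) + L * (L * β) := by
    intro i j
    by_cases hij : i = j
    · subst hij
      rw [inner_sum_self_of_const hx (a := α)
        (fun u hu w hw huw => hnadj u w huw (hi i u (hIs i hu) w (hIs i hw))), hI]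
      simp
    · rw [inner_sum_sum_of_const (a := β)
        (fun u hu w hw => hadj u w (hm i j hij u (hIs i hu) w (hIs j hw))), hI, hI]
      simp [hij]
  have h0 : 0 ≤ inner ℝ (∑ i, ∑ u ∈ I i, x u) (∑ i, ∑ u ∈ I i, x u) := real_inner_self_nonneg
  have e2 : inner ℝ (∑ i, ∑ u ∈ I i, x u) (∑ i, ∑ u ∈ I i, x u) =
      (p + 1) * (L * ((1 - α) + L * (α + p * β))) := by
    simp only [sum_inner (s := Finset.univ), inner_sum (s := Finset.univ), e1]
    simp only [Finset.sum_add_distrib, Finset.sum_ite_eq, Finset.mem_univ, if_true,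
      Finset.sum_const, Finset.card_univ, Fintype.card_fin, nsmul_eq_mul]
    push_cast
    ring
  rw [e2] at h0
  have := mul_neg_of_pos_of_neg (by positivity : (0 : ℝ) < p + 1) (mul_neg_of_pos_of_neg hLpos hL)
  linarith

end Code

open scoped Classical in
theorem exists_partition_of_code {α β : ℝ} (hβ0 : β < 0) (hα0 : 0 ≤ α) (p : ℕ)
    (hp : α + p * β < 0) :
    ∃ C D : ℕ, ∀ (d : ℕ) (V : Type) [Fintype V] (x : V → EuclideanSpace ℝ (Fin d)),
      (∀ u, ‖x u‖ = 1) → (∀ u w, u ≠ w → inner ℝ (x u) (x w) = α ∨ inner ℝ (x u) (x w) = β) →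
      ∃ f : V → Option (Fin p), (Finset.univ.filter (fun v => f v = none)).card ≤ C ∧
        ∀ v i, f v = some i →
          (Finset.univ.filter (fun w => f w = some i ∧ inner ℝ (x v) (x w) = β)).card ≤ D ∧
          ∀ j, j ≠ i →
            (Finset.univ.filter (fun w => f w = some j ∧ inner ℝ (x v) (x w) ≠ β)).card ≤ D := by
  obtain ⟨K, hK⟩ := exists_nat_gt ((1 - β) / (-β))
  have hK' : (1 - β) + K * β < 0 := by
    rw [div_lt_iff₀ (by linarith)] at hK
    linarith
  have hK0 : 1 ≤ K := by
    rcases Nat.eq_zero_or_pos K with rfl | h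
    · norm_num at hK'
      linarith
    · exact h
  have hγ : 0 < (α - β) ^ 2 := pow_pos (by linarith) 2
  obtain ⟨L₁, hL₁⟩ := exists_nat_gt (2 * (1 - α) / (α - β) ^ 2)
  obtain ⟨L₂, hL₂⟩ := exists_nat_gt ((1 - α) / (-(α + p * β)))
  rw [div_lt_iff₀ hγ] at hL₁
  rw [div_lt_iff₀ (by linarith)] at hL₂
  set L := L₁ + L₂ + 1 with hLdef
  have c1 : (L₁ : ℝ) ≤ L := by exact_mod_cast (by omega : L₁ ≤ L)
  have c2 : (L₂ : ℝ) ≤ L := by exact_mod_cast (by omega : L₂ ≤ L)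
  have hs : 2 * (1 - α) < L * (α - β) ^ 2 :=
    hL₁.trans_le (mul_le_mul_of_nonneg_right c1 hγ.le)
  have hm : (1 - α) + L * (α + p * β) < 0 := by nlinarith
  obtain ⟨C, D, h⟩ := exists_bounded_degree_partition K L p (by omega)
  refine ⟨C, D, ?_⟩
  intro d V _ x hx hin
  let G : SimpleGraph V :=
    { Adj := fun u w => inner ℝ (x u) (x w) = β
      symm := ⟨fun u w h => by rw [real_inner_comm, h]⟩
      loopless := ⟨fun u h => by
        rw [real_inner_self_eq_norm_sq, hx] at h
        linarith⟩ }
  have hadj : ∀ u w, G.Adj u w → inner ℝ (x u) (x w) = β := fun u w h => h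
  have hnadj : ∀ u w, u ≠ w → ¬ G.Adj u w → inner ℝ (x u) (x w) = α := fun u w huw h =>
    (hin u w huw).resolve_right h
  obtain ⟨f, hf0, hf⟩ := h V G (noClique_of_code hx hadj hK0 hK')
    (noSplit_of_code hx hadj hnadj (by omega) hs)
    (not_isMultipartite_of_code hx hadj hnadj (by omega) hm)
  refine ⟨f, by convert hf0, fun v i hvi => ⟨?_, fun j hj => ?_⟩⟩
  · convert (hf v i hvi).1
  · convert (hf v i hvi).2 j hj

/-! ### Combining the parts and choosing `ε`. -/

/-- Finitely many parts, any two of which have total size at most `B`. -/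
theorem sum_le_of_pairwise {p : ℕ} (hp : 1 ≤ p) (a : Fin p → ℝ) {B : ℝ} (hB : ∀ i, a i ≤ B)
    (hB2 : ∀ i j, i ≠ j → a i + a j ≤ B) : ∑ i, a i ≤ max 1 ((p : ℝ) / 2) * B := by
  obtain rfl | hp2 : p = 1 ∨ 2 ≤ p := by omega
  · rw [Fin.sum_univ_one, max_eq_left (by norm_num), one_mul]
    exact hB 0
  · have h2 : (2 : ℝ) ≤ p := by exact_mod_cast hp2
    rw [max_eq_right (by linarith)]
    obtain ⟨n, rfl⟩ : ∃ n, p = n + 2 := ⟨p - 2, by omega⟩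
    -- In the cyclic sum of consecutive pairs every part occurs twice; `p ≥ 2` makes the members of
    -- a pair distinct.
    have h1 : ∑ i, a (finRotate (n + 2) i) = ∑ i, a i := Equiv.sum_comp _ a
    have h3 : ∑ i, (a i + a (finRotate (n + 2) i)) ≤ ∑ _i : Fin (n + 2), B :=
      Finset.sum_le_sum fun i _ => hB2 _ _ (by
        rw [finRotate_apply]
        simp)
    rw [Finset.sum_add_distrib, h1] at h3
    simp only [Finset.sum_const, Finset.card_univ, Fintype.card_fin, nsmul_eq_mul] at h3
    linarith

open scoped Classical in
/-- The uniform linear bound for finite two-distance codes. -/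
theorem exists_card_code_le {α β c ε : ℝ} (hβ0 : β < 0) (hα0 : 0 ≤ α) (hα : α < 1)
    (hc : c = (1 - α) / (α - β)) (hε : 0 < ε) (hε1 : ε < 1) (p : ℕ) (hp1 : 1 ≤ p)
    (hp : α + p * β < 0)
    (hk : ∀ k : ℕ, (∃ G : SimpleGraph (Fin k), IsTopEigenvalue G c) → 1 ≤ ε * k) :
    ∃ C : ℝ, ∀ (d : ℕ) (S : Finset (EuclideanSpace ℝ (Fin d))),
      IsSphericalCode {α, β} (S : Set (EuclideanSpace ℝ (Fin d))) →
        (S.card : ℝ) ≤ max 1 ((p : ℝ) / 2) * (d / (1 - ε)) + C := by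
  obtain ⟨C₀, D, hpart⟩ := exists_partition_of_code hβ0 hα0 p hp
  obtain ⟨C₁, hpair⟩ := exists_card_le_of_two_parts (by linarith : β < α) hα hc hε (D + D) hk
  refine ⟨max 1 ((p : ℝ) / 2) * (C₁ / (1 - ε)) + C₀, ?_⟩
  intro d S hS
  let x : S → EuclideanSpace ℝ (Fin d) := fun u => u
  have hx : ∀ u, ‖x u‖ = 1 := fun u => hS.1 u u.2
  have hin : ∀ u w, u ≠ w → inner ℝ (x u) (x w) = α ∨ inner ℝ (x u) (x w) = β :=
    fun u w huw => hS.2 u u.2 w w.2 fun h => huw (Subtype.ext h)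
  obtain ⟨f, hf0, hf⟩ := hpart d S x hx hin
  have hεp : 0 < 1 - ε := by linarith
  -- The case `i = j` is included and bounds a single part, as is needed when `p = 1`.
  have hij : ∀ i j, ((Finset.univ.filter (fun v => f v = some i ∨ f v = some j)).card : ℝ) ≤
      (d + C₁) / (1 - ε) := by
    intro i j
    have h1 := hpair d {v : S // f v = some i ∨ f v = some j} (fun v => x v)
      (fun v => decide (f v = some i)) (fun v => hx v)
      (fun u w huw => hin u w fun h => huw (Subtype.ext h)) (by
        rintro ⟨v, hv⟩
        have key : ∀ i' j', (f v = some i') → (∀ w, (f w = some i ∨ f w = some j) →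
            inner ℝ (x v) (x w) = (if (decide (f v = some i)) = (decide (f w = some i))
              then β else α) →
            (f w = some i' ∧ inner ℝ (x v) (x w) = β) ∨
              (j' ≠ i' ∧ f w = some j' ∧ inner ℝ (x v) (x w) ≠ β)) →
            (Finset.univ.filter (fun w : {v : S // f v = some i ∨ f v = some j} =>
              ⟨v, hv⟩ ≠ w ∧ inner ℝ (x v) (x w) =
                if (decide (f v = some i)) = (decide (f w = some i)) then β else α)).card
              ≤ D + D := by
          intro i' j' hvi hsub
          rw [← Finset.card_map (Function.Embedding.subtype _)]
          have hss : Finset.map (Function.Embedding.subtype _)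
              (Finset.univ.filter (fun w : {v : S // f v = some i ∨ f v = some j} =>
                ⟨v, hv⟩ ≠ w ∧ inner ℝ (x v) (x w) =
                if (decide (f v = some i)) = (decide (f w = some i)) then β else α)) ⊆
              (Finset.univ.filter (fun w => f w = some i' ∧ inner ℝ (x v) (x w) = β)) ∪
              (Finset.univ.filter (fun w => j' ≠ i' ∧ f w = some j' ∧
                inner ℝ (x v) (x w) ≠ β)) := by
            intro w hw
            obtain ⟨w', hw', rfl⟩ := Finset.mem_map.mp hw
            have := hsub w' w'.2 (Finset.mem_filter.mp hw').2.2
            simpa using this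
          refine (Finset.card_le_card hss).trans ((Finset.card_union_le _ _).trans
            (Nat.add_le_add (hf v i' hvi).1 ?_))
          by_cases hji : j' = i'
          · simp [hji]
          · simpa [hji] using (hf v i' hvi).2 j' hji
        have hab : α ≠ β := by linarith
        by_cases hvi : f v = some i
        · convert key i j hvi ?_
          intro w hw h
          by_cases hwi : f w = some i
          · left
            simpa [hvi, hwi] using h
          · right
            have hwj := hw.resolve_left hwi
            simp only [hvi, hwi, decide_true, decide_false] at h
            refine ⟨fun e => hwi (e ▸ hwj), hwj, ?_⟩
            simp at h
            rw [h]
            exact hab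
        · have hvj := hv.resolve_left hvi
          convert key j i hvj ?_
          intro w hw h
          by_cases hwi : f w = some i
          · right
            refine ⟨fun e => hvi (e ▸ hvj), hwi, ?_⟩
            simp [hvi, hwi] at h
            rw [h]
            exact hab
          · left
            refine ⟨hw.resolve_left hwi, ?_⟩
            simpa [hvi, hwi] using h)
    rw [le_div_iff₀ hεp, mul_comm]
    rwa [Fintype.card_subtype] at h1
  let a : Fin p → ℝ := fun i => ((Finset.univ.filter (fun v => f v = some i)).card : ℝ)
  have hsum := sum_le_of_pairwise hp1 a (B := (d + C₁) / (1 - ε))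
    (fun i => by simpa only [or_self] using hij i i) (fun i j hne => by
      refine le_trans (le_of_eq ?_) (hij i j)
      rw [Finset.filter_or, Finset.card_union_of_disjoint, Nat.cast_add]
      rw [Finset.disjoint_filter]
      intro v _ h1 h2
      exact hne (Option.some.inj (h1.symm.trans h2)))
  have hcard : (S.card : ℝ) = (Finset.univ.filter (fun v => f v = none)).card + ∑ i, a i := by
    have h1 := Finset.card_eq_sum_card_fiberwise (s := (Finset.univ : Finset S)) (f := f)
      (t := Finset.univ) (by simp)
    rw [Fintype.sum_option, Finset.card_univ, Fintype.card_coe] at h1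
    rw [h1]
    push_cast
    rfl
  have hC0 : ((Finset.univ.filter (fun v => f v = none)).card : ℝ) ≤ C₀ := by exact_mod_cast hf0
  rw [hcard]
  have : max 1 ((p : ℝ) / 2) * ((d + C₁) / (1 - ε)) =
      max 1 ((p : ℝ) / 2) * (d / (1 - ε)) + max 1 ((p : ℝ) / 2) * (C₁ / (1 - ε)) := by ring
  linarith

/-- Subsets of codes are codes, so an infinite or oversized code would contain a finite one of size
`⌊B⌋₊ + 1`. -/
theorem maxCodeSize_le_of_finset {A : Set ℝ} {d : ℕ} {B : ℝ}
    (h : ∀ S : Finset (EuclideanSpace ℝ (Fin d)),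
      IsSphericalCode A (S : Set (EuclideanSpace ℝ (Fin d))) → (S.card : ℝ) ≤ B) :
    maxCodeSize A d ≤ (⌊B⌋₊ : ℕ∞) := by
  refine iSup₂_le fun S hS => ?_
  have hfin : ∀ F : Finset (EuclideanSpace ℝ (Fin d)), (F : Set _) ⊆ S → F.card ≤ ⌊B⌋₊ :=
    fun F hF => Nat.le_floor (h F ⟨fun x hx => hS.1 x (hF hx),
      fun x hx y hy => hS.2 x (hF hx) y (hF hy)⟩)
  by_contra! hlt
  obtain ⟨T, hTS, hT⟩ := Set.exists_subset_encard_eq (Order.add_one_le_of_lt hlt)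
  have hTf : T.Finite := Set.finite_of_encard_eq_coe (k := ⌊B⌋₊ + 1) (by rw [hT]; rfl)
  have := hfin hTf.toFinset (by simpa using hTS)
  rw [hTf.encard_eq_coe_toFinset_card] at hT
  have h2 : hTf.toFinset.card = ⌊B⌋₊ + 1 := by exact_mod_cast hT
  omega

theorem theorem1p10 (α β : ℝ) (hβ : -1 ≤ β) (hβ0 : β < 0) (hα0 : 0 ≤ α) (hα : α < 1)
    (lam : ℝ) (hlam : lam = (1 - α) / (α - β))
    (p : ℤ) (hp : p = ⌊-α / β⌋ + 1)
    (q : ℝ) (hq : q = max 1 ((p : ℝ) / 2)) :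
    (∀ d : ℕ, maxCodeSize {α, β} d ≠ ⊤) ∧
    (∀ k : ℕ, spectralRadiusOrder lam = (k : ℕ∞) →
      ∃ C : ℝ, ∀ d : ℕ, ((maxCodeSize {α, β} d).toNat : ℝ) ≤
        q * (k : ℝ) * (d : ℝ) / ((k : ℝ) - 1) + C) ∧
    (spectralRadiusOrder lam = ⊤ →
      ∃ f : ℕ → ℝ, Asymptotics.IsLittleO Filter.atTop f (fun d : ℕ => (d : ℝ)) ∧
        ∀ d : ℕ, ((maxCodeSize {α, β} d).toNat : ℝ) ≤ q * (d : ℝ) + f d) := by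
  have hlam0 : 0 < lam := by
    rw [hlam]
    exact div_pos (by linarith) (by linarith)
  have hfl : 0 ≤ ⌊-α / β⌋ := Int.floor_nonneg.mpr (div_nonneg_of_nonpos (by linarith) hβ0.le)
  obtain ⟨n, rfl⟩ : ∃ n : ℕ, p = n := ⟨p.toNat, by omega⟩
  -- The floor in `p` makes `n > -α / β`, which is the negativity that excludes `n + 1` large parts.
  have hn1 : 1 ≤ n := by omega
  have hnβ : α + n * β < 0 := by
    have h1 : -α / β < n := by
      have h2 := Int.lt_floor_add_one (-α / β)
      have h3 : ((n : ℤ) : ℝ) = ⌊-α / β⌋ + 1 := by rw [hp]; push_cast; rfl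
      rw [← h3] at h2
      exact_mod_cast h2
    rw [div_lt_iff_of_neg hβ0] at h1
    linarith
  rw [Int.cast_natCast] at hq
  have hq0 : 0 < q := by
    rw [hq]
    exact lt_max_of_lt_left one_pos
  have hbound : ∀ ε : ℝ, 0 < ε → ε < 1 →
      (∀ k : ℕ, (∃ G : SimpleGraph (Fin k), IsTopEigenvalue G lam) → 1 ≤ ε * k) →
      ∃ C : ℝ, 0 ≤ C ∧ ∀ d : ℕ, maxCodeSize {α, β} d ≤ (⌊q * (d / (1 - ε)) + C⌋₊ : ℕ∞) ∧
        ((maxCodeSize {α, β} d).toNat : ℝ) ≤ q * (d / (1 - ε)) + C := by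
    intro ε hε hε1 hk
    obtain ⟨C, hC⟩ := exists_card_code_le hβ0 hα0 hα hlam hε hε1 n hn1 hnβ hk
    rw [← hq] at hC
    refine ⟨max C 0, le_max_right _ _, fun d => ?_⟩
    have h1 := maxCodeSize_le_of_finset (A := {α, β}) (d := d)
      (B := q * (d / (1 - ε)) + max C 0) (fun S hS => (hC d S hS).trans
        (by linarith [le_max_left C 0]))
    refine ⟨h1, ?_⟩
    have h2 : (maxCodeSize {α, β} d).toNat ≤ ⌊q * (d / (1 - ε)) + max C 0⌋₊ :=
      ENat.toNat_le_of_le_natCast h1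
    have h3 : 0 ≤ q * ((d : ℝ) / (1 - ε)) + max C 0 :=
      add_nonneg (mul_nonneg hq0.le (div_nonneg (Nat.cast_nonneg _) (by linarith)))
        (le_max_right _ _)
    exact (Nat.cast_le.mpr h2).trans (Nat.floor_le h3)
  have hle : ∀ k : ℕ, (∃ G : SimpleGraph (Fin k), IsTopEigenvalue G lam) →
      spectralRadiusOrder lam ≤ k := fun k hk => iInf₂_le k hk
  refine ⟨?_, ?_, ?_⟩
  · intro d
    obtain ⟨C, -, hC⟩ := hbound (1 / 2) (by norm_num) (by norm_num) (by
      rintro k ⟨G, hG⟩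
      have : (2 : ℝ) ≤ k := by exact_mod_cast two_le_of_isTopEigenvalue hlam0 hG
      linarith)
    exact ne_top_of_le_ne_top (ENat.natCast_ne_top _) (hC d).1
  · intro k hk
    have hk2 : 2 ≤ k := by
      have : (2 : ℕ∞) ≤ spectralRadiusOrder lam := by
        refine le_iInf₂ fun m ⟨G, hG⟩ => ?_
        exact_mod_cast two_le_of_isTopEigenvalue hlam0 hG
      rw [hk] at this
      exact_mod_cast this
    have hk2' : (2 : ℝ) ≤ k := by exact_mod_cast hk2
    have hkpos : (0 : ℝ) < k := by linarith
    -- With `ε = 1 / k`, the factor `1 / (1 - ε)` is `k / (k - 1)`.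
    obtain ⟨C, -, hC⟩ := hbound (1 / k) (by positivity)
      (by rw [div_lt_one hkpos]; linarith) (by
        intro m hm
        have h1 := hle m hm
        rw [hk] at h1
        have h2 : (k : ℝ) ≤ m := by exact_mod_cast h1
        rw [one_div, inv_mul_eq_div, le_div_iff₀ hkpos, one_mul]
        exact h2)
    refine ⟨C, fun d => ((hC d).2).trans (le_of_eq ?_)⟩
    have : (k : ℝ) - 1 ≠ 0 := by linarith
    field_simp
  · intro htop
    have hno : ∀ k : ℕ, ¬ ∃ G : SimpleGraph (Fin k), IsTopEigenvalue G lam := by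
      intro k hk
      have := hle k hk
      rw [htop] at this
      exact ENat.natCast_ne_top k (top_le_iff.mp this)
    refine ⟨fun d => max ((maxCodeSize {α, β} d).toNat - q * d) 0, ?_, fun d => ?_⟩
    · rw [Asymptotics.isLittleO_iff]
      intro δ hδ
      have hε1 : δ / 2 / (q + δ / 2) < 1 := by
        rw [div_lt_one (by positivity)]
        linarith
      -- No graph has largest eigenvalue `lam`, so every `ε` is admissible; this one solves `q / (1
      -- - ε) = q + δ / 2`, and the other `δ / 2 * d` absorbs `C`.
      obtain ⟨C, hC0, hC⟩ := hbound (δ / 2 / (q + δ / 2)) (by positivity) hε1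
        (fun k hk => absurd hk (hno k))
      obtain ⟨n₀, hn₀⟩ := exists_nat_ge (C / (δ / 2))
      filter_upwards [Filter.eventually_ge_atTop n₀] with d hd
      rw [Real.norm_of_nonneg (le_max_right _ _), Real.norm_of_nonneg (Nat.cast_nonneg d)]
      refine max_le ?_ (by positivity)
      have h1 := (hC d).2
      have h2 : q * ((d : ℝ) / (1 - δ / 2 / (q + δ / 2))) = (q + δ / 2) * d := by
        have : 1 - δ / 2 / (q + δ / 2) = q / (q + δ / 2) := by
          field_simp
          ring
        rw [this]
        field_simp
      have h3 : C ≤ δ / 2 * d := by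
        have : C / (δ / 2) ≤ d := hn₀.trans (by exact_mod_cast hd)
        rw [div_le_iff₀ (by positivity)] at this
        linarith
      rw [h2] at h1
      linarith
    · linarith [le_max_left (((maxCodeSize {α, β} d).toNat : ℝ) - q * d) 0]
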